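/- **Theorem (criterion of micro-indecomposable homogeneity).** *Conventions.* A *Poisson bracket* on a smooth manifold $M$ is an $\mathbb R$-bilinear skew-symmetric operation on $C^\infty(M)$ satisfying the Leibniz and Jacobi identities, extended complex-bilinearly to complex-valued functions; two Poisson brackets $\{,\}_1,\{,\}_2$ are *compatible* if all combinations $a_1\{,\}_1+a_2\{,\}_2$, $a_1,a_2\in\mathbb R$, are Poisson. A *Casimir function* of a bracket is a smooth function whose bracket with every smooth function vanishes. The *associated pairing* of $\{,\}$ on $\mathcal T_m^*M$ is $(df|_m,dg|_m)=\{f,g\}|_m$. Smooth real functions $f_1,\dots,f_r$ on an open set $V$ are *dependent* if every point of $V$ has a neighbourhood on which $\varphi(f_1,\dots,f_r)\equiv0$ for some smooth $\varphi:\mathbb R^r\to\mathbb R$ which does not vanish identically on any nonempty open subset of $\mathbb R^r$; otherwise they are *independent*. A pair of bilinear pairings on a nonzero vector space is *indecomposable* if it is not the direct sum of two pairs on nonzero spaces. The structure $(M,\{,\}_1,\{,\}_2)$ is *homogeneous of type $(t_1,\dots,t_l)$ on* $U\subset M$ if for every $m\in U$ the pair of associated pairings on $\mathcal T^*_mM$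 is a direct sum of indecomposable pairs of dimensions $t_1,\dots,t_l$. *Statement.* Let $M$ be a (Hausdorff) $C^\infty$ manifold with $\dim M\neq0$, with two compatible Poisson brackets $\{,\}_1,\{,\}_2$. Let $\mathcal U\subset\mathbb R$ be open and let $F_\lambda$, $\lambda\in\mathcal U$, be a family of smooth real- or complex-valued functions on $M$ such that for every $\lambda\in\mathcal U$ the function $F_\lambda$ is a Casimir function of $\lambda\{,\}_1+\{,\}_2$, and such that for every $m\in M$ the differential $dF_\lambda|_m$ depends continuously on $\lambda\in\mathcal U$. Let $W_1(m)$ be the span of all $dF_\lambda|_m$, $\lambda\in\mathcal U$, in $\mathcal T_m^*M$ (in $\mathcal T_m^*M\otimes\mathbb C$, over $\mathbb C$, if the $F_\lambda$ are complex-valued). Suppose that 1. for some $m_0\in M$ one has $\dim W_1(m_0)\ge\frac{\dim M}{2}$; 2. for some $\lambda_1,\lambda_2\in\mathbb R$ the point $m_0$ has an open neighbourhood $N$ such that on every open $V\subset N$ any two (real-valued) Casimir functions of the restriction of $\lambda_1\{,\}_1+\lambda_2\{,\}_2$ to $V$ are dependent. Then $\dim M$ is odd, and there is an open set $U\subset M$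 with $m_0\in\overline U$ on which the structure is homogeneous of type $(\dim M)$; that is, writing $\dim M=2k-1$, at every $m\in U$ the pair of associated pairings on $\mathcal T_m^*M$ is a single Kronecker block: $\mathcal T^*_mM$ has a basis $w_0,\dots,w_{2k-2}$ in which the only nonzero pairings, up to skew-symmetry, are $(w_{2l},w_{2l+1})_1=1$ and $(w_{2l+1},w_{2l+2})_2=1$, $0\le l\le k-2$. -/

import Mathlib

open Set Filter
open scoped Manifold ContDiff Topology

noncomputable section

/-! ### Pairs of bilinear pairings on a real vector space -/

section LinearAlgebra

variable {V : Type*} [AddCommGroup V] [Module ℝ V]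

/-- A pair of bilinear pairings on `V` is indecomposable if `V ≠ 0` and the pair is not
a direct sum of two pairs on nonzero spaces: whenever `V` is the direct sum of two subspaces that
are orthogonal for both pairings, one of the two is zero. -/
def IsIndecomposablePair (b₁ b₂ : LinearMap.BilinForm ℝ V) : Prop :=
  Nontrivial V ∧
    ∀ P Q : Submodule ℝ V, IsCompl P Q →
      (∀ x ∈ P, ∀ y ∈ Q, b₁ x y = 0 ∧ b₁ y x = 0 ∧ b₂ x y = 0 ∧ b₂ y x = 0) →
        P = ⊥ ∨ Q = ⊥

/-- The pair `(b₁, b₂)` is a direct sum of indecomposable pairs whose dimensions are the entries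
of the list `t`. -/
def DecomposesIntoBlocks (b₁ b₂ : LinearMap.BilinForm ℝ V) (t : List ℕ) : Prop :=
  ∃ W : Fin t.length → Submodule ℝ V,
    DirectSum.IsInternal W ∧
    (∀ i j, i ≠ j → ∀ x ∈ W i, ∀ y ∈ W j, b₁ x y = 0 ∧ b₂ x y = 0) ∧
    ∀ i, Module.finrank ℝ (W i) = t.get i ∧
      IsIndecomposablePair (b₁.restrict (W i)) (b₂.restrict (W i))

/-- The Kronecker pair of (odd) dimension `N = 2k - 1`: there is a basis `w₀, …, w_{2k-2}` with
`(w_{2l}, w_{2l+1})₁ = 1` and `(w_{2l+1}, w_{2l+2})₂ = 1` for `0 ≤ l ≤ k - 2`, all the other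
pairings of basis vectors being zero, up to skew symmetry. -/
def IsKroneckerPair (N : ℕ) (b₁ b₂ : LinearMap.BilinForm ℝ V) : Prop :=
  Odd N ∧ ∃ w : Module.Basis (Fin N) ℝ V, ∀ i j : Fin N,
    b₁ (w i) (w j) =
      (if Even (i : ℕ) ∧ (j : ℕ) = i + 1 then 1
        else if Even (j : ℕ) ∧ (i : ℕ) = j + 1 then -1 else 0) ∧
    b₂ (w i) (w j) =
      (if Odd (i : ℕ) ∧ (j : ℕ) = i + 1 then 1
        else if Odd (j : ℕ) ∧ (i : ℕ) = j + 1 then -1 else 0)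

end LinearAlgebra

/-! ### Brackets on a manifold -/

section Brackets

variable {n : ℕ} {M : Type*} [TopologicalSpace M] [ChartedSpace (EuclideanSpace ℝ (Fin n)) M]

/-- The cotangent space of `M` at `m`. -/
abbrev Cotangent (n : ℕ) {M : Type*} [TopologicalSpace M]
    [ChartedSpace (EuclideanSpace ℝ (Fin n)) M] (m : M) : Type :=
  TangentSpace (𝓡 n) m →L[ℝ] ℝ

/-- Real-bilinear operations on the space of smooth real functions on `M`. -/
abbrev BilinearOperation (n : ℕ) (M : Type*) [TopologicalSpace M]
    [ChartedSpace (EuclideanSpace ℝ (Fin n)) M] : Type _ :=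
  C^∞⟮𝓡 n, M; ℝ⟯ →ₗ[ℝ] C^∞⟮𝓡 n, M; ℝ⟯ →ₗ[ℝ] C^∞⟮𝓡 n, M; ℝ⟯

/-- A bracket: skew-symmetric, with the Leibniz identity. -/
def IsBracket (B : BilinearOperation n M) : Prop :=
  (∀ f g, B f g = -B g f) ∧ ∀ f g h, B f (g * h) = g * B f h + h * B f g

/-- A Poisson bracket: a bracket with the Jacobi identity. -/
def IsPoisson (B : BilinearOperation n M) : Prop :=
  IsBracket B ∧ ∀ f g h, B f (B g h) + B g (B h f) + B h (B f g) = 0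

/-- Two compatible Poisson brackets, i.e. a bihamiltonian structure on `M`. -/
def IsBihamiltonian (B₁ B₂ : BilinearOperation n M) : Prop :=
  IsPoisson B₁ ∧ IsPoisson B₂ ∧ ∀ a₁ a₂ : ℝ, IsPoisson (a₁ • B₁ + a₂ • B₂)

/-- The pairing on the cotangent space at `m` associated to the bracket `B`:
`(α, β) = {f, g}(m)` if `α = df(m)` and `β = dg(m)`. -/
def IsAssociatedPairing (B : BilinearOperation n M) (m : M)
    (b : LinearMap.BilinForm ℝ (Cotangent n m)) : Prop :=
  ∀ f g : C^∞⟮𝓡 n, M; ℝ⟯, b (mvfderiv (𝓡 n) f m) (mvfderiv (𝓡 n) g m) = B f g m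

/-- The pair of brackets is homogeneous of type `t` on `U`: at every point of `U` the associated
pair of pairings on the cotangent space is a direct sum of indecomposable blocks of dimensions `t`.
-/
def IsHomogeneousOn (B₁ B₂ : BilinearOperation n M) (t : List ℕ) (U : Set M) : Prop :=
  ∀ m ∈ U, ∃ b₁ b₂ : LinearMap.BilinForm ℝ (Cotangent n m),
    IsAssociatedPairing B₁ m b₁ ∧ IsAssociatedPairing B₂ m b₂ ∧ DecomposesIntoBlocks b₁ b₂ t

/-- At every point of `U` the associated pair of pairings on the cotangent space is
isomorphic to the Kronecker pair of dimension `N`. -/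
def IsKroneckerAtPointsOf (B₁ B₂ : BilinearOperation n M) (N : ℕ) (U : Set M) : Prop :=
  ∀ m ∈ U, ∃ b₁ b₂ : LinearMap.BilinForm ℝ (Cotangent n m),
    IsAssociatedPairing B₁ m b₁ ∧ IsAssociatedPairing B₂ m b₂ ∧ IsKroneckerPair N b₁ b₂

/-! ### Casimir functions -/

section Extended

variable {𝕜 : Type*} [RCLike 𝕜]

/-- The real part of a smooth real- or complex-valued function. -/
def rePart (F : C^∞⟮𝓡 n, M; 𝓘(ℝ, 𝕜), 𝕜⟯) : C^∞⟮𝓡 n, M; ℝ⟯ :=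
  ⟨fun x => RCLike.re (F x), (RCLike.reCLM (K := 𝕜)).contDiff.comp_contMDiff F.contMDiff⟩

/-- The imaginary part of a smooth real- or complex-valued function. -/
def imPart (F : C^∞⟮𝓡 n, M; 𝓘(ℝ, 𝕜), 𝕜⟯) : C^∞⟮𝓡 n, M; ℝ⟯ :=
  ⟨fun x => RCLike.im (F x), (RCLike.imCLM (K := 𝕜)).contDiff.comp_contMDiff F.contMDiff⟩

/-- The `𝕜`-bilinear extension of a bracket to `𝕜`-valued functions (`𝕜 = ℝ` or `ℂ`); for `𝕜 = ℝ`
it is the bracket itself. -/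
def extendedBracket (B : BilinearOperation n M) (F G : C^∞⟮𝓡 n, M; 𝓘(ℝ, 𝕜), 𝕜⟯) (m : M) : 𝕜 :=
  ((B (rePart F) (rePart G) m - B (imPart F) (imPart G) m : ℝ) : 𝕜) +
    RCLike.I * ((B (rePart F) (imPart G) m + B (imPart F) (rePart G) m : ℝ) : 𝕜)

/-- A Casimir function on `M`: its bracket with every smooth function vanishes. -/
def IsCasimir (B : BilinearOperation n M) (F : C^∞⟮𝓡 n, M; 𝓘(ℝ, 𝕜), 𝕜⟯) : Prop :=
  ∀ (G : C^∞⟮𝓡 n, M; 𝓘(ℝ, 𝕜), 𝕜⟯) (m : M), extendedBracket B F G m = 0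

/-- The subspace `W₁(m)` of the (for `𝕜 = ℂ`: complexified) cotangent space at `m` spanned by the
differentials `dF_s(m)`, `s ∈ S`. -/
def differentialSpan (F : ℝ → C^∞⟮𝓡 n, M; 𝓘(ℝ, 𝕜), 𝕜⟯) (S : Set ℝ) (m : M) :
    Submodule 𝕜 (TangentSpace (𝓡 n) m →L[ℝ] 𝕜) :=
  Submodule.span 𝕜 ((fun s => mvfderiv (𝓡 n) (F s) m) '' S)

end Extended

/-- `f` is a smooth function on the open set `V` and a Casimir function for the restriction of the
bracket `B` to `V`. The value of `B` at a point depends only on the germs of its arguments there,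
and every germ of a smooth function is the germ of a global one; this is how `B` restricts to `V`.
-/
def IsCasimirOn (B : BilinearOperation n M) (V : Set M) (f : M → ℝ) : Prop :=
  ContMDiffOn (𝓡 n) 𝓘(ℝ, ℝ) ∞ f V ∧
    ∀ m ∈ V, ∀ f' g : C^∞⟮𝓡 n, M; ℝ⟯, (f' : M → ℝ) =ᶠ[𝓝 m] f → B f' g m = 0

/-- Functional dependence of `f₁, …, f_r` on the open set `V`: locally on `V` one has
`φ (f₁, …, f_r) = 0` for a smooth function `φ` on `ℝ^r` that does not vanish identically on any
nonempty open subset of `ℝ^r`. -/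
def AreDependentOn {r : ℕ} (V : Set M) (f : Fin r → M → ℝ) : Prop :=
  ∀ m ∈ V, ∃ φ : (Fin r → ℝ) → ℝ,
    ContDiff ℝ ∞ φ ∧
    (∀ O : Set (Fin r → ℝ), IsOpen O → O.Nonempty → ∃ y ∈ O, φ y ≠ 0) ∧
    ∀ᶠ x in 𝓝 m, φ (fun i => f i x) = 0

/-- On the open set `V` there are at most `r` independent Casimir functions of `B`. -/
def HasAtMostIndependentCasimirs (B : BilinearOperation n M) (r : ℕ) (V : Set M) : Prop :=
  ∀ f : Fin (r + 1) → M → ℝ, (∀ i, IsCasimirOn B V (f i)) → AreDependentOn V f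

end Brackets

end

/-! ### Pencils of bilinear forms: parity of the rank and generic corank. -/

section AlternatingPencils

variable {V : Type*} [AddCommGroup V] [Module ℝ V] [FiniteDimensional ℝ V]

/-! The hypothesis on dependent Casimir functions bounds the corank of one bracket of the pencil at
points arbitrarily near `m₀`, and linear algebra in each cotangent space does the rest.

If the bracket with coefficients `a₁`, `a₂` had corank at least two on a whole neighbourhood of
`m₀`, the Hamiltonian fields of the coordinates would form an involutive family of rank at most `n -
2`. A Frobenius theorem that needs no constant rank (`IsInvolutiveFamily.exists_firstIntegrals`)
would then give, on some open subset, two common first integrals with independent differentials,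
that is, two independent Casimir functions (`IsCoordinateMap.exists_independent_casimirs`). So
points of corank at most one accumulate at `m₀`. This condition is open, and so is the bound on the
dimension spanned by the differentials of the `F s`; together they hold on an open set with `m₀` in
its closure.

Fix such a point. Corank at most one for one member of the pencil forces it for `s • b₁ + b₂` with
all but finitely many `s`. For these `s` the differential of `F s` lies in the kernel of `s • b₁ +
b₂`. Continuity in `s` places the remaining differentials in the span of these kernels too, so the
span has at least half the dimension.

It remains to recognise the pair (`isKroneckerPair_of_finrank_le`). A nonzero kernel in corank at
most one makes the dimension odd, `2p + 1`. There are `p + 1` independent kernel vectors `e j`, for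
distinct `s j`, and they span a subspace isotropic for both forms. The covectors `b₁ (e j)` satisfy
a single relation, which after rescaling reads `∑ j, b₁ (e j) = 0`. Polynomial combinations of the
`e j` then form a chain `w 0, …, w p` with `b₁ (w i) = -b₂ (w (i + 1))`; interleaved with dual
vectors from a complement isotropic for both forms, it is the Kronecker basis. Indecomposability
follows from parity. -/

theorem LinearMap.BilinForm.ker_eq_bot_iff_det_toMatrix_ne_zero {ι : Type*} [Fintype ι]
    [DecidableEq ι] (b : LinearMap.BilinForm ℝ V) (v : Module.Basis ι ℝ V) :
    LinearMap.ker b = ⊥ ↔ (LinearMap.BilinForm.toMatrix v b).det ≠ 0 := by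
  rw [← LinearMap.separatingLeft_iff_ker_eq_bot]
  rw [← Matrix.separatingLeft_iff_det_ne_zero, LinearMap.BilinForm.separatingLeft_toMatrix_iff]

/-- Transposition changes the sign of the Gram matrix, so in odd size its determinant equals its own
negative. -/
theorem LinearMap.BilinForm.IsAlt.even_finrank_of_ker_eq_bot {b : LinearMap.BilinForm ℝ V}
    (hb : b.IsAlt) (h : LinearMap.ker b = ⊥) : Even (Module.finrank ℝ V) := by
  by_contra hodd
  rw [Nat.not_even_iff_odd] at hodd
  let v := Module.finBasis ℝ V
  rw [b.ker_eq_bot_iff_det_toMatrix_ne_zero v] at h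
  apply h
  have hT : (LinearMap.BilinForm.toMatrix v b).transpose = -LinearMap.BilinForm.toMatrix v b := by
    ext i j
    simp [LinearMap.BilinForm.toMatrix_apply, ← hb.neg_eq (v i) (v j)]
  have := congrArg Matrix.det hT
  rw [Matrix.det_transpose, Matrix.det_neg, Fintype.card_fin, hodd.neg_one_pow] at this
  linarith

/-- The form is nondegenerate on any complement of its kernel, so that complement is
even-dimensional. -/
theorem LinearMap.BilinForm.IsAlt.exists_finrank_eq_add {b : LinearMap.BilinForm ℝ V}
    (hb : b.IsAlt) :
    ∃ r, Even r ∧ Module.finrank ℝ V = r + Module.finrank ℝ (LinearMap.ker b) := by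
  obtain ⟨Q, hQ⟩ := Submodule.exists_isCompl (LinearMap.ker b)
  refine ⟨Module.finrank ℝ Q, ?_, ?_⟩
  · have halt : (b.restrict Q).IsAlt := fun x => hb x
    apply halt.even_finrank_of_ker_eq_bot
    rw [LinearMap.ker_eq_bot']
    intro x hx
    have hxk : (x : V) ∈ LinearMap.ker b := by
      rw [LinearMap.mem_ker]
      ext z
      obtain ⟨k, hk, q, hq, rfl⟩ := Submodule.mem_sup.1
        (hQ.sup_eq_top ▸ Submodule.mem_top : z ∈ LinearMap.ker b ⊔ Q)
      have h1 : b x q = 0 := by simpa using congrArg (fun f => f ⟨q, hq⟩) hx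
      have h2 : b x k = 0 := by
        rw [← hb.neg_eq, LinearMap.mem_ker.1 hk]; simp
      simp [h1, h2]
    have := hQ.disjoint.le_bot ⟨hxk, x.2⟩
    exact Subtype.ext (by simpa using this)
  · rw [add_comm, Submodule.finrank_add_eq_of_isCompl hQ]

/-- Take `w` nonzero on the kernel and `u` outside the range. Together with the converse below, this
turns "corank at most one" into the nonvanishing of a determinant. -/
theorem LinearMap.BilinForm.exists_ker_add_smulRight_eq_bot (b : LinearMap.BilinForm ℝ V)
    (h : Module.finrank ℝ (LinearMap.ker b) ≤ 1) :
    ∃ w u : Module.Dual ℝ V, LinearMap.ker (b + w.smulRight u) = ⊥ := by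
  by_cases h0 : LinearMap.ker b = ⊥
  · exact ⟨0, 0, by simpa using h0⟩
  obtain ⟨k, hk, hk0⟩ := Submodule.exists_mem_ne_zero_of_ne_bot h0
  have hspan : ∀ x ∈ LinearMap.ker b, ∃ c : ℝ, c • k = x := by
    intro x hx
    obtain ⟨c, hc⟩ := (finrank_le_one_iff.1 h)
    obtain ⟨a, ha⟩ := hc ⟨k, hk⟩
    obtain ⟨d, hd⟩ := hc ⟨x, hx⟩
    have ha' : a • (c : V) = k := congrArg Subtype.val ha
    have hd' : d • (c : V) = x := congrArg Subtype.val hd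
    have ha0 : a ≠ 0 := by rintro rfl; exact hk0 (by rw [← ha']; simp)
    exact ⟨d / a, by rw [← ha', ← hd', smul_smul, div_mul_cancel₀ _ ha0]⟩
  obtain ⟨w, hw⟩ : ∃ w : Module.Dual ℝ V, w k ≠ 0 := by
    by_contra! hcon
    exact hk0 ((Module.forall_dual_apply_eq_zero_iff ℝ k).1 hcon)
  obtain ⟨u, hu⟩ : ∃ u : Module.Dual ℝ V, u ∉ LinearMap.range b := by
    by_contra! hcon
    apply h0
    rw [LinearMap.ker_eq_bot]
    exact (LinearMap.injective_iff_surjective_of_finrank_eq_finrank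
      (Subspace.dual_finrank_eq (K := ℝ) (V := V)).symm).2 hcon
  refine ⟨w, u, LinearMap.ker_eq_bot'.2 fun x hx => ?_⟩
  have hx' : b x + w x • u = 0 := hx
  have hwx : w x = 0 := by
    by_contra hne
    apply hu
    refine ⟨-(w x)⁻¹ • x, ?_⟩
    rw [map_smul, eq_neg_of_add_eq_zero_left hx', smul_neg, neg_smul, neg_neg, smul_smul,
      inv_mul_cancel₀ hne, one_smul]
  rw [hwx, zero_smul, add_zero] at hx'
  obtain ⟨c, rfl⟩ := hspan x hx'
  have : c = 0 := by simpa [hw] using hwx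
  simp [this]

theorem LinearMap.BilinForm.finrank_ker_le_one_of_ker_add_smulRight_eq_bot
    {b : LinearMap.BilinForm ℝ V} {w u : Module.Dual ℝ V}
    (h : LinearMap.ker (b + w.smulRight u) = ⊥) : Module.finrank ℝ (LinearMap.ker b) ≤ 1 := by
  have hinj : Function.Injective (w.domRestrict (LinearMap.ker b)) := by
    rw [← LinearMap.ker_eq_bot, LinearMap.ker_eq_bot']
    intro x hx
    have hx' : w x = 0 := hx
    have : (x : V) ∈ LinearMap.ker (b + w.smulRight u) := by
      have hbx : b x = 0 := x.2
      simp [hbx, hx']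
    rw [h] at this
    exact Subtype.ext (by simpa using this)
  simpa using LinearMap.finrank_le_finrank_of_injective hinj

/-- The exceptional parameters are roots of the determinant, a polynomial in `s` that is nonzero
because of `s₀`. -/
theorem LinearMap.BilinForm.finite_setOf_ker_smul_add_ne_bot (b c : LinearMap.BilinForm ℝ V)
    (s₀ : ℝ) (h : LinearMap.ker (s₀ • b + c) = ⊥) :
    {s : ℝ | LinearMap.ker (s • b + c) ≠ ⊥}.Finite := by
  let v := Module.finBasis ℝ V
  let p : Polynomial ℝ := ((Polynomial.X : Polynomial ℝ) •
    (LinearMap.BilinForm.toMatrix v b).map Polynomial.C +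
    (LinearMap.BilinForm.toMatrix v c).map Polynomial.C).det
  have hp : ∀ s, p.eval s = (LinearMap.BilinForm.toMatrix v (s • b + c)).det := by
    intro s
    rw [← Polynomial.coe_evalRingHom, RingHom.map_det]
    congr 1
    ext i j
    simp [LinearMap.BilinForm.toMatrix_apply]
    ring
  have hp0 : p ≠ 0 := by
    intro h0
    have := (LinearMap.BilinForm.ker_eq_bot_iff_det_toMatrix_ne_zero _ v).1 h
    rw [← hp, h0] at this
    simp at this
  refine (p.roots.toFinset.finite_toSet).subset fun s hs => ?_
  simp only [Finset.mem_coe, Multiset.mem_toFinset, Polynomial.mem_roots hp0, Polynomial.IsRoot,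
    hp]
  by_contra hne
  exact hs ((LinearMap.BilinForm.ker_eq_bot_iff_det_toMatrix_ne_zero _ v).2 hne)

/-- If some member of a pencil of bilinear forms has corank at most one, then so have all but
finitely many of the forms `s • b₁ + b₂`. -/
theorem LinearMap.BilinForm.finite_setOf_one_lt_finrank_ker (b₁ b₂ : LinearMap.BilinForm ℝ V)
    (a₁ a₂ : ℝ) (h : Module.finrank ℝ (LinearMap.ker (a₁ • b₁ + a₂ • b₂)) ≤ 1) :
    {s : ℝ | 1 < Module.finrank ℝ (LinearMap.ker (s • b₁ + b₂))}.Finite := by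
  have hker : ∀ (c : ℝ) (b : LinearMap.BilinForm ℝ V), c ≠ 0 →
      LinearMap.ker (c • b) = LinearMap.ker b := fun c b hc => LinearMap.ker_smul b c hc
  by_cases ha₂ : a₂ = 0
  · by_cases ha₁ : a₁ = 0
    · rw [ha₁, ha₂, zero_smul, zero_smul, add_zero, LinearMap.ker_zero, finrank_top] at h
      convert Set.finite_empty
      rw [Set.eq_empty_iff_forall_notMem]
      intro s hs
      exact absurd (hs.trans_le ((Submodule.finrank_le _).trans h)) (lt_irrefl _)
    -- Here the good member is `b₁`, the point at infinity of the affine pencil. The argument runs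
    -- in the parameter `s⁻¹`, and `s = 0` is set aside.
    · rw [ha₂, zero_smul, add_zero, hker _ _ ha₁] at h
      obtain ⟨w, u, hwu⟩ := b₁.exists_ker_add_smulRight_eq_bot h
      have hfin := LinearMap.BilinForm.finite_setOf_ker_smul_add_ne_bot b₂ (b₁ + w.smulRight u) 0
        (by simpa using hwu)
      refine ((hfin.image (fun t => t⁻¹)).union (Set.finite_singleton 0)).subset fun s hs => ?_
      by_contra hcon
      simp only [Set.mem_union, Set.mem_image, Set.mem_singleton_iff, not_or, not_exists,
        not_and] at hcon
      have h1 := hcon.1 s⁻¹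
      simp only [inv_inv, not_true_eq_false, imp_false, Set.mem_ofPred_eq, ne_eq, not_not] at h1
      rw [← add_assoc] at h1
      have h2 := LinearMap.BilinForm.finrank_ker_le_one_of_ker_add_smulRight_eq_bot h1
      rw [← hker s _ hcon.2, smul_add, smul_smul, mul_inv_cancel₀ hcon.2, one_smul, add_comm] at h2
      exact absurd (hs.trans_le h2) (lt_irrefl _)
  · have hk : LinearMap.ker (a₁ • b₁ + a₂ • b₂) = LinearMap.ker ((a₁ / a₂) • b₁ + b₂) := by
      rw [← hker a₂ ((a₁ / a₂) • b₁ + b₂) ha₂, smul_add, smul_smul, mul_div_cancel₀ _ ha₂]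
    rw [hk] at h
    obtain ⟨w, u, hwu⟩ := LinearMap.BilinForm.exists_ker_add_smulRight_eq_bot _ h
    rw [add_assoc] at hwu
    have hfin := LinearMap.BilinForm.finite_setOf_ker_smul_add_ne_bot b₁ _ _ hwu
    refine hfin.subset fun s hs hcon => ?_
    rw [← add_assoc] at hcon
    exact absurd (hs.trans_le
      (LinearMap.BilinForm.finrank_ker_le_one_of_ker_add_smulRight_eq_bot hcon)) (lt_irrefl _)

/-- Finitely many linearly independent functionals take prescribed values at some vector. -/
theorem LinearIndependent.exists_forall_dual_apply_eq {ι : Type*} [Fintype ι]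
    {f : ι → Module.Dual ℝ V} (hf : LinearIndependent ℝ f) (a : ι → ℝ) :
    ∃ x, ∀ i, f i x = a i := by
  classical
  have hsurj : Function.Surjective (LinearMap.pi f) := by
    rw [← LinearMap.range_eq_top]
    by_contra hne
    obtain ⟨φ, hφ0, hφ⟩ := Submodule.exists_le_ker_of_lt_top _ (lt_top_iff_ne_top.2 hne)
    apply hφ0
    have hsum : ∑ i, φ (Pi.single i 1) • f i = 0 := by
      ext x
      have h1 : φ (LinearMap.pi f x) = 0 := hφ ⟨x, rfl⟩
      rw [LinearMap.pi_apply_eq_sum_univ φ] at h1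
      have h2 : ∀ i, (Pi.single i 1 : ι → ℝ) = fun j => if i = j then 1 else 0 := by
        intro i
        ext j
        simp [Pi.single_apply, eq_comm]
      simpa [h2, mul_comm] using h1
    have := Fintype.linearIndependent_iff.1 hf _ hsum
    ext i
    simpa using this i
  obtain ⟨x, hx⟩ := hsurj a
  exact ⟨x, fun i => congrFun hx i⟩

end AlternatingPencils

/-! ### Kernel vectors of a pencil: isotropy, relations and chains. -/

section KroneckerPairs

variable {V : Type*} [AddCommGroup V] [Module ℝ V] [FiniteDimensional ℝ V]

/-- Linearly independent vectors `e i` spanning the kernels of the members `s i • b₁ + b₂` of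
a pencil, for distinct `s i`. -/
structure IsKernelFamily (b₁ b₂ : LinearMap.BilinForm ℝ V) {ι : Type*} (e : ι → V)
    (s : ι → ℝ) : Prop where
  linearIndependent : LinearIndependent ℝ e
  injective : Function.Injective s
  snd_apply : ∀ i, b₂ (e i) = -(s i • b₁ (e i))
  eq_smul : ∀ i x, s i • b₁ x + b₂ x = 0 → ∃ c : ℝ, x = c • e i

namespace IsKernelFamily

variable {b₁ b₂ : LinearMap.BilinForm ℝ V} {ι : Type*} {e : ι → V} {s : ι → ℝ}

/-- Evaluating `b₂ (e i) (e j)` through either argument gives `-s i` or `-s j` times `b₁ (e i) (e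
j)`, and `s i ≠ s j`. -/
theorem isotropic (h : IsKernelFamily b₁ b₂ e s) (h₁ : b₁.IsAlt) (h₂ : b₂.IsAlt) (i j : ι) :
    b₁ (e i) (e j) = 0 := by
  by_cases hij : i = j
  · rw [hij]; exact h₁ _
  have e1 : b₂ (e i) (e j) = -(s i * b₁ (e i) (e j)) := by rw [h.snd_apply]; simp
  have e2 : b₂ (e j) (e i) = -(s j * b₁ (e j) (e i)) := by rw [h.snd_apply]; simp
  rw [← h₁.neg_eq, ← h₂.neg_eq, e1] at e2
  have hs : s i - s j ≠ 0 := sub_ne_zero.2 fun hs => hij (h.injective hs)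
  apply mul_left_cancel₀ hs
  linarith

theorem isotropic_snd (h : IsKernelFamily b₁ b₂ e s) (h₁ : b₁.IsAlt) (h₂ : b₂.IsAlt) (i j : ι) :
    b₂ (e i) (e j) = 0 := by
  rw [h.snd_apply]
  simp [h.isotropic h₁ h₂]

variable [Fintype ι]

/-- The form `s i • b₁ + b₂` sends `e j` to `(s i - s j) • b₁ (e j)`. Dividing the coefficients by
`s i - s j` thus turns the relation into a kernel vector, a multiple of `e i`. The quotient by zero
at `j = i` does no harm because `c i = 0`. -/
theorem eq_zero_of_sum_smul_eq_zero (h : IsKernelFamily b₁ b₂ e s) {c : ι → ℝ}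
    (hc : ∑ j, c j • b₁ (e j) = 0) {i : ι} (hi : c i = 0) (j : ι) : c j = 0 := by
  classical
  have hx : s i • b₁ (∑ j, (c j / (s i - s j)) • e j) + b₂ (∑ j, (c j / (s i - s j)) • e j) = 0 := by
    rw [← hc, map_sum, map_sum, Finset.smul_sum, ← Finset.sum_add_distrib]
    refine Finset.sum_congr rfl fun j _ => ?_
    rw [map_smul, map_smul, h.snd_apply, smul_neg, smul_smul, smul_smul, ← sub_eq_add_neg,
      ← sub_smul]
    by_cases hij : i = j
    · subst hij; simp [hi]
    · have hs : s i - s j ≠ 0 := sub_ne_zero.2 fun hs => hij (h.injective hs)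
      congr 1
      field_simp
  obtain ⟨a, ha⟩ := h.eq_smul i _ hx
  by_cases hij : i = j
  · rw [← hij, hi]
  have hlin : ∑ j, (c j / (s i - s j) - if j = i then a else 0) • e j = 0 := by
    simp only [sub_smul, Finset.sum_sub_distrib, ha, ite_smul, zero_smul, Finset.sum_ite_eq',
      Finset.mem_univ, if_true, sub_self]
  have := Fintype.linearIndependent_iff.1 h.linearIndependent _ hlin j
  have hs : s i - s j ≠ 0 := sub_ne_zero.2 fun hs => hij (h.injective hs)
  simpa [Ne.symm hij, hs] using this

/-- By isotropy all `b₁ (e j)` lie in the annihilator of the span of `e`, whose dimension is smaller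
than their number. -/
theorem exists_sum_smul_eq_zero (h : IsKernelFamily b₁ b₂ e s) (h₁ : b₁.IsAlt) (h₂ : b₂.IsAlt)
    (hcard : Module.finrank ℝ V < 2 * Fintype.card ι) :
    ∃ c : ι → ℝ, ∑ j, c j • b₁ (e j) = 0 ∧ ∃ j, c j ≠ 0 := by
  apply Fintype.not_linearIndependent_iff.1
  intro hli
  have hle : Submodule.span ℝ (range fun j => b₁ (e j)) ≤
      (Submodule.span ℝ (range e)).dualAnnihilator := by
    rw [Submodule.span_le]
    rintro _ ⟨j, rfl⟩
    rw [SetLike.mem_coe, Submodule.mem_dualAnnihilator]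
    intro x hx
    induction hx using Submodule.span_induction with
    | mem x hx => obtain ⟨i, rfl⟩ := hx; exact h.isotropic h₁ h₂ j i
    | zero => simp
    | add x y _ _ hx hy => simp [hx, hy]
    | smul a x _ hx => simp [hx]
  have h1 := Submodule.finrank_mono hle
  have h2 := Subspace.finrank_add_finrank_dualAnnihilator_eq (Submodule.span ℝ (range e))
  rw [finrank_span_eq_card hli] at h1
  rw [finrank_span_eq_card h.linearIndependent] at h2
  linarith

theorem smul (h : IsKernelFamily b₁ b₂ e s) {c : ι → ℝ} (hc : ∀ i, c i ≠ 0) :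
    IsKernelFamily b₁ b₂ (fun i => c i • e i) s where
  linearIndependent := h.linearIndependent.units_smul fun i => Units.mk0 (c i) (hc i)
  injective := h.injective
  snd_apply i := by simp only [map_smul, h.snd_apply, smul_neg, smul_comm (c i) (s i)]
  eq_smul i x hx := by
    obtain ⟨a, rfl⟩ := h.eq_smul i x hx
    exact ⟨a / c i, by rw [smul_smul, div_mul_cancel₀ _ (hc i)]⟩

variable {p : ℕ} {e : Fin (p + 1) → V} {s : Fin (p + 1) → ℝ}

/-- Any dual vectors `c₀` may be changed by combinations of the isotropic `e j` without affecting
the duality; this freedom suffices to kill both forms at once. -/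
theorem exists_isotropic_dual (h : IsKernelFamily b₁ b₂ e s) (h₁ : b₁.IsAlt) (h₂ : b₂.IsAlt) :
    ∃ c : Fin p → V, (∀ j l, b₁ (e (Fin.castSucc j)) (c l) = if j = l then 1 else 0) ∧
      (∀ l m, b₁ (c l) (c m) = 0) ∧ ∀ l m, b₂ (c l) (c m) = 0 := by
  have hli : LinearIndependent ℝ fun j : Fin p => b₁ (e (Fin.castSucc j)) := by
    rw [Fintype.linearIndependent_iff]
    intro a ha j
    have := h.eq_zero_of_sum_smul_eq_zero (c := Fin.snoc (α := fun _ => ℝ) a 0) (i := Fin.last p)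
      (by rw [Fin.sum_univ_castSucc]; simpa using ha) (by simp) (Fin.castSucc j)
    simpa using this
  choose c₀ hc₀ using fun l : Fin p =>
    hli.exists_forall_dual_apply_eq (fun j => if j = l then (1 : ℝ) else 0)
  let t : Fin p → ℝ := fun l => s (Fin.castSucc l)
  -- For each pair `l ≠ m` the two vanishing conditions are `d l m - d m l = b₁ (c₀ l) (c₀ m)` and
  -- `t m * d m l - t l * d l m = b₂ (c₀ l) (c₀ m)`, solvable since `t l ≠ t m`.
  let d : Fin p → Fin p → ℝ := fun l m =>
    -(b₂ (c₀ l) (c₀ m) + t m * b₁ (c₀ l) (c₀ m)) / (t l - t m)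
  let D : Fin p → V := fun m => ∑ j, d j m • e (Fin.castSucc j)
  have hiso : ∀ l m, b₁ (D l) (D m) = 0 := by
    intro l m
    simp [D, h.isotropic h₁ h₂]
  have hiso₂ : ∀ l m, b₂ (D l) (D m) = 0 := by
    intro l m
    simp [D, h.isotropic_snd h₁ h₂]
  have hDc : ∀ l m, b₁ (D l) (c₀ m) = d m l := by
    intro l m
    simp [D, hc₀]
  have hDc₂ : ∀ l m, b₂ (D l) (c₀ m) = -(t m * d m l) := by
    intro l m
    simp [D, hc₀, h.snd_apply, t, mul_comm]
  have hcD : ∀ l m, b₁ (c₀ l) (D m) = -d l m := by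
    intro l m
    rw [← h₁.neg_eq, hDc]
  have hcD₂ : ∀ l m, b₂ (c₀ l) (D m) = t l * d l m := by
    intro l m
    rw [← h₂.neg_eq, hDc₂, neg_neg]
  have ht : ∀ l m, l ≠ m → t l - t m ≠ 0 := fun l m hlm =>
    sub_ne_zero.2 fun hs => hlm (Fin.castSucc_injective _ (h.injective hs))
  refine ⟨fun l => c₀ l + D l, ?_, ?_, ?_⟩
  · intro j l
    have : b₁ (e (Fin.castSucc j)) (D l) = 0 := by simp [D, h.isotropic h₁ h₂]
    simp [this, hc₀]
  · intro l m
    by_cases hlm : l = m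
    · subst hlm; exact h₁ _
    simp only [map_add, LinearMap.add_apply, hiso, hDc, hcD]
    have e1 := ht l m hlm
    have e2 := ht m l (Ne.symm hlm)
    simp only [d, ← h₁.neg_eq (c₀ l) (c₀ m), ← h₂.neg_eq (c₀ l) (c₀ m)]
    field_simp
    ring
  · intro l m
    by_cases hlm : l = m
    · subst hlm; exact h₂ _
    simp only [map_add, LinearMap.add_apply, hiso₂, hDc₂, hcD₂]
    have e1 := ht l m hlm
    have e2 := ht m l (Ne.symm hlm)
    simp only [d, ← h₁.neg_eq (c₀ l) (c₀ m), ← h₂.neg_eq (c₀ l) (c₀ m)]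
    field_simp
    ring

open Polynomial in
/-- The coefficients, as a polynomial in the pencil parameter, of the kernel vector of the pencil. -/
theorem exists_horner_chain (h : IsKernelFamily b₁ b₂ e s) (hsum : ∑ j, b₁ (e j) = 0) :
    ∃ w : ℕ → V, LinearIndependent ℝ (fun i : Fin (p + 1) => w i) ∧
      (∀ i, w i ∈ Submodule.span ℝ (range e)) ∧
      w p = ∑ j, e j ∧ b₁ (w p) = 0 ∧ (∀ i, b₁ (w i) = -b₂ (w (i + 1))) ∧ b₂ (w 0) = 0 := by
  -- With `φ r = ∑ j, r(s j) • e j` one has `b₂ (φ r) = -b₁ (φ (X * r))`, and `hsum` makes `b₁ ∘ φ`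
  -- blind to constants. Hence the chain comes from polynomials with `q i = X * q (i + 1) + const`:
  -- the Horner quotients of `P`, which vanishes at all `s j`.
  let P : ℝ[X] := ∏ j, (X - C (s j))
  have hPm : P.Monic := monic_prod_X_sub_C s Finset.univ
  have hPd : P.natDegree = p + 1 := by
    simp [P, natDegree_prod_of_monic, monic_X_sub_C]
  have hPs : ∀ j, P.eval (s j) = 0 := by
    intro j
    simp only [P, eval_prod]
    exact Finset.prod_eq_zero (Finset.mem_univ j) (by simp)
  let q : ℕ → ℝ[X] := fun i => divX^[i + 1] P
  have hq : ∀ i, q i = X * q (i + 1) + C ((q i).coeff 0) := by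
    intro i
    conv_lhs => rw [← X_mul_divX_add (q i)]
    simp only [q, Function.iterate_succ_apply' divX (i + 1)]
  have hcoeff : ∀ i k, (divX^[i] P).coeff k = P.coeff (k + i) := by
    intro i
    induction i with
    | zero => simp
    | succ i ih =>
      intro k
      rw [Function.iterate_succ_apply', coeff_divX, ih]
      congr 1
      omega
  have hqp : q p = 1 := by
    ext k
    rw [hcoeff, coeff_one]
    split_ifs with hk
    · rw [hk, zero_add, ← hPd]; exact hPm
    · exact coeff_eq_zero_of_natDegree_lt (by omega)
  let φ : ℝ[X] → V := fun r => ∑ j, r.eval (s j) • e j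
  have hφ₁ : ∀ r, b₁ (φ r) = ∑ j, r.eval (s j) • b₁ (e j) := by
    intro r; simp only [φ, map_sum, map_smul]
  have hφ₂ : ∀ r, b₂ (φ r) = -∑ j, (X * r).eval (s j) • b₁ (e j) := by
    intro r
    simp only [φ, map_sum, map_smul, h.snd_apply, smul_neg, Finset.sum_neg_distrib, smul_smul,
      eval_mul, eval_X, mul_comm]
  have hconst : ∀ (r : ℝ[X]) (c : ℝ), ∑ j, (r + C c).eval (s j) • b₁ (e j) =
      ∑ j, r.eval (s j) • b₁ (e j) := by
    intro r c
    simp only [eval_add, eval_C, add_smul, Finset.sum_add_distrib, ← Finset.smul_sum, hsum,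
      smul_zero, add_zero]
  refine ⟨fun i => φ (q i), ?_, ?_, ?_, ?_, ?_, ?_⟩
  · rw [Fintype.linearIndependent_iff]
    intro a ha
    have h0 : ∀ j, ∑ i : Fin (p + 1), a i * (q i).eval (s j) = 0 := by
      refine Fintype.linearIndependent_iff.1 h.linearIndependent _ ?_
      rw [← ha]
      simp only [φ, Finset.smul_sum, Finset.sum_smul, smul_smul]
      exact Finset.sum_comm
    have hdeg : ∀ i : Fin (p + 1), (q i).natDegree ≤ p := by
      intro i
      rw [natDegree_le_iff_coeff_eq_zero]
      intro N hN
      rw [hcoeff]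
      exact coeff_eq_zero_of_natDegree_lt (by omega)
    have hR : ∑ i : Fin (p + 1), C (a i) * q i = 0 := by
      refine eq_zero_of_natDegree_lt_card_of_eval_eq_zero _ h.injective (fun j => ?_) ?_
      · simpa [eval_finsetSum] using h0 j
      · rw [Fintype.card_fin]
        refine Nat.lt_succ_of_le (natDegree_sum_le_of_forall_le _ _ fun i _ => ?_)
        exact (natDegree_C_mul_le _ _).trans (hdeg i)
    -- Triangularity: `q i` is monic of degree `p - i`, so the coefficient in that degree isolates
    -- `a i` once the earlier ones vanish.
    have hk : ∀ k, ∀ i : Fin (p + 1), (i : ℕ) < k → a i = 0 := by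
      intro k
      induction k with
      | zero => intro i hi; omega
      | succ k ih =>
        intro i hi
        have h1 := congrArg (fun r => coeff r (p - i)) hR
        simp only [finsetSum_coeff, coeff_C_mul, coeff_zero] at h1
        rw [Finset.sum_eq_single i] at h1
        · rw [hcoeff, show p - (i : ℕ) + (i + 1) = P.natDegree by omega] at h1
          rw [show P.coeff P.natDegree = 1 from hPm, mul_one] at h1
          exact h1
        · intro j _ hji
          rcases lt_or_gt_of_ne hji with hlt | hgt
          · rw [ih j (by have : (j : ℕ) < i := hlt; omega), zero_mul]
          · have : (i : ℕ) < j := hgt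
            rw [hcoeff, coeff_eq_zero_of_natDegree_lt (by omega), mul_zero]
        · simp
    intro i
    exact hk (i + 1) i (Nat.lt_succ_self _)
  · intro i
    exact Submodule.sum_mem _ fun j _ =>
      Submodule.smul_mem _ _ (Submodule.subset_span (mem_range_self j))
  · simp [hqp, φ]
  · simp [hqp, φ, hsum]
  · intro i
    rw [hφ₁, hφ₂, neg_neg, hq i, hconst]
  · change b₂ (φ (q 0)) = 0
    have h1 : P = X * q 0 + C (P.coeff 0) := (X_mul_divX_add P).symm
    rw [hφ₂, ← hconst (X * q 0) (P.coeff 0), ← h1]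
    simp [hPs]

end IsKernelFamily

end KroneckerPairs

/-! ### The Kronecker basis and indecomposability. -/

section KroneckerPairs

variable {V : Type*} [AddCommGroup V] [Module ℝ V] [FiniteDimensional ℝ V]

namespace IsKernelFamily

variable {b₁ b₂ : LinearMap.BilinForm ℝ V} {p : ℕ} {e : Fin (p + 1) → V} {s : Fin (p + 1) → ℝ}

/-- The basis interleaves the chain `w` with vectors `u`, taken in the span of the isotropic `c` and
dual to `w 0, …, w (p - 1)` under `b₁`. The shift relation of the chain then dictates `b₂`. -/
theorem isKroneckerPair (h : IsKernelFamily b₁ b₂ e s) (h₁ : b₁.IsAlt) (h₂ : b₂.IsAlt)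
    (hsum : ∑ j, b₁ (e j) = 0) (hdim : Module.finrank ℝ V = 2 * p + 1) :
    IsKroneckerPair (2 * p + 1) b₁ b₂ := by
  obtain ⟨c, hec, hcc₁, hcc₂⟩ := h.exists_isotropic_dual h₁ h₂
  obtain ⟨w, hwli, hwe, hwp, hw₁p, hw₁, hw₂⟩ := h.exists_horner_chain hsum
  have hspan : ∀ x ∈ Submodule.span ℝ (range e), ∃ a : Fin (p + 1) → ℝ, x = ∑ j, a j • e j := by
    intro x hx
    obtain ⟨a, ha⟩ := (Submodule.mem_span_range_iff_exists_fun ℝ).1 hx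
    exact ⟨a, ha.symm⟩
  have hww₁ : ∀ i j, b₁ (w i) (w j) = 0 := by
    intro i j
    obtain ⟨a, ha⟩ := hspan _ (hwe i)
    obtain ⟨a', ha'⟩ := hspan _ (hwe j)
    simp [ha, ha', h.isotropic h₁ h₂]
  have hww₂ : ∀ i j, b₂ (w i) (w j) = 0 := by
    intro i j
    obtain ⟨a, ha⟩ := hspan _ (hwe i)
    obtain ⟨a', ha'⟩ := hspan _ (hwe j)
    simp [ha, ha', h.isotropic_snd h₁ h₂]
  have hlast : ∀ l, b₁ (e (Fin.last p)) (c l) = -1 := by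
    intro l
    have := congrArg (fun f => f (c l)) hsum
    simp only [Fin.sum_univ_castSucc, LinearMap.add_apply, LinearMap.sum_apply, hec,
      Finset.sum_ite_eq', Finset.mem_univ, if_true, LinearMap.zero_apply] at this
    linarith
  -- functionals on the coordinate space of the span of `c`
  let f : Fin p → Module.Dual ℝ (Fin p → ℝ) := fun i =>
    (b₁ (w i)).comp (Fintype.linearCombination ℝ c)
  -- A combination of `w 0, …, w (p - 1)` that is `b₁`-orthogonal to every `c l` has equal
  -- coordinates along all `e j`. It is thus a multiple of `∑ j, e j = w p`, and the chain is
  -- independent.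
  have hf : LinearIndependent ℝ f := by
    rw [Fintype.linearIndependent_iff]
    intro a ha i
    obtain ⟨x, hx⟩ := hspan _ (Submodule.sum_mem _ fun i (_ : i ∈ Finset.univ) =>
      Submodule.smul_mem _ (a i) (hwe i))
    have hxl : ∀ l, x (Fin.castSucc l) = x (Fin.last p) := by
      intro l
      have h0 : b₁ (∑ i : Fin p, a i • w i) (c l) = 0 := by
        have := congrArg (fun g => g (Pi.single l 1)) ha
        simpa [f, Fintype.linearCombination_apply_single] using this
      rw [hx] at h0
      simp only [map_add, map_sum, map_smul, Fin.sum_univ_castSucc, LinearMap.add_apply,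
        LinearMap.sum_apply, LinearMap.smul_apply, hec, hlast, smul_eq_mul, mul_ite, mul_one,
        mul_zero, Finset.sum_ite_eq', Finset.mem_univ, if_true] at h0
      linarith
    have hxw : ∑ i : Fin p, a i • w i = x (Fin.last p) • w p := by
      rw [hx, hwp, Finset.smul_sum]
      refine Finset.sum_congr rfl fun j _ => ?_
      refine Fin.lastCases rfl (fun l => ?_) j
      rw [hxl]
    have hrel : ∑ i : Fin (p + 1),
        (Fin.snoc (α := fun _ => ℝ) a (-x (Fin.last p)) i) • w i = 0 := by
      rw [Fin.sum_univ_castSucc]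
      simp [hxw]
    have := Fintype.linearIndependent_iff.1 hwli _ hrel (Fin.castSucc i)
    simpa using this
  choose y hy using fun l : Fin p =>
    hf.exists_forall_dual_apply_eq (fun j => if j = l then (1 : ℝ) else 0)
  let u : ℕ → V := fun l => if hl : l < p then Fintype.linearCombination ℝ c (y ⟨l, hl⟩) else 0
  have huu : ∀ b : LinearMap.BilinForm ℝ V, (∀ l m, b (c l) (c m) = 0) →
      ∀ l m, b (u l) (u m) = 0 := by
    intro b hb l m
    simp only [u]
    split_ifs <;> simp [Fintype.linearCombination_apply, hb]
  have hwu₁ : ∀ i l, i ≤ p → l < p → b₁ (w i) (u l) = if i = l then 1 else 0 := by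
    intro i l hi hl
    rcases hi.lt_or_eq with hi | rfl
    · have := hy ⟨l, hl⟩ ⟨i, hi⟩
      simpa [f, u, hl] using this
    · rw [hw₁p, if_neg (by omega)]; simp
  have hwu₂ : ∀ i l, i ≤ p → l < p → b₂ (w i) (u l) = if i = l + 1 then -1 else 0 := by
    intro i l hi hl
    cases i with
    | zero => rw [hw₂, if_neg (by omega)]; simp
    | succ i =>
      rw [← neg_eq_iff_eq_neg.2 (hw₁ i)]
      simp [hwu₁ i l (by omega) hl, apply_ite]
  let v : ℕ → V := fun k => if Even k then w (k / 2) else u (k / 2)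
  have hv₀ : ∀ a, v (2 * a) = w a := by
    intro a; simp [v]
  have hv₁ : ∀ a, v (2 * a + 1) = u a := by
    intro a; simp [v, show (2 * a + 1) / 2 = a by omega]
  have hli : LinearIndependent ℝ fun i : Fin (2 * p + 1) => v i := by
    have hsumli : LinearIndependent ℝ
        (Sum.elim (fun i : Fin (p + 1) => w i) (fun l : Fin p => u l)) := by
      rw [Fintype.linearIndependent_iff]
      intro g hg
      rw [Fintype.sum_sum_type] at hg
      simp only [Sum.elim_inl, Sum.elim_inr] at hg
      have hr : ∀ l, g (Sum.inr l) = 0 := by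
        intro l
        have := congrArg (b₁ (w l)) hg
        simp only [map_add, map_sum, map_smul, hww₁, smul_zero, Finset.sum_const_zero, zero_add,
          map_zero] at this
        rw [Finset.sum_congr rfl fun m _ => by
          rw [hwu₁ l m l.2.le m.2]] at this
        simpa [Fin.val_inj] using this
      simp only [hr, zero_smul, Finset.sum_const_zero, add_zero] at hg
      rintro (i | l)
      · exact Fintype.linearIndependent_iff.1 hwli _ hg i
      · exact hr l
    let σ : Fin (2 * p + 1) → Fin (p + 1) ⊕ Fin p := fun i =>
      if hi : Even (i : ℕ) then Sum.inl ⟨i / 2, by omega⟩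
      else Sum.inr ⟨i / 2, by rw [Nat.not_even_iff] at hi; omega⟩
    have hσ : Function.Injective σ := by
      intro i j hij
      simp only [σ] at hij
      split_ifs at hij with hi hj hj
      · have := congrArg Fin.val (Sum.inl_injective hij)
        rw [Nat.even_iff] at hi hj
        simp only at this
        exact Fin.ext (by omega)
      · have := congrArg Fin.val (Sum.inr_injective hij)
        rw [Nat.not_even_iff] at hi hj
        simp only at this
        exact Fin.ext (by omega)
    convert hsumli.comp σ hσ using 1
    ext i
    simp only [σ, v, Function.comp]
    split_ifs <;> rfl
  refine ⟨⟨p, rfl⟩, basisOfLinearIndependentOfCardEqFinrank hli (by simp [hdim]), ?_⟩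
  intro i j
  simp only [coe_basisOfLinearIndependentOfCardEqFinrank]
  have huw₁ : ∀ i l, i ≤ p → l < p → b₁ (u l) (w i) = if i = l then -1 else 0 := by
    intro i l hi hl
    rw [← h₁.neg_eq, hwu₁ i l hi hl]; split_ifs <;> simp
  have huw₂ : ∀ i l, i ≤ p → l < p → b₂ (u l) (w i) = if i = l + 1 then 1 else 0 := by
    intro i l hi hl
    rw [← h₂.neg_eq, hwu₂ i l hi hl]; split_ifs <;> simp
  have hi := i.2
  have hj := j.2
  rcases Nat.even_or_odd' (i : ℕ) with ⟨a, ha | ha⟩ <;>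
    rcases Nat.even_or_odd' (j : ℕ) with ⟨b, hb | hb⟩ <;>
    rw [ha, hb] <;> simp only [hv₀, hv₁]
  · rw [hww₁, hww₂]
    simp only [Nat.even_iff, Nat.odd_iff]
    constructor <;> rw [if_neg (by omega), if_neg (by omega)]
  · rw [hwu₁ a b (by omega) (by omega), hwu₂ a b (by omega) (by omega)]
    simp only [Nat.even_iff, Nat.odd_iff]
    constructor
    · rw [if_neg (c := (2 * b + 1) % 2 = 0 ∧ _) (by omega)]
      exact if_congr (by omega) rfl rfl
    · rw [if_neg (c := (2 * a) % 2 = 1 ∧ _) (by omega)]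
      exact if_congr (by omega) rfl rfl
  · rw [huw₁ b a (by omega) (by omega), huw₂ b a (by omega) (by omega)]
    simp only [Nat.even_iff, Nat.odd_iff]
    constructor
    · rw [if_neg (c := (2 * a + 1) % 2 = 0 ∧ _) (by omega)]
      exact if_congr (by omega) rfl rfl
    · rw [if_neg (c := (2 * b) % 2 = 1 ∧ _) (by omega)]
      exact if_congr (by omega) rfl rfl
  · rw [huu b₁ hcc₁, huu b₂ hcc₂]
    simp only [Nat.even_iff, Nat.odd_iff]
    constructor <;> rw [if_neg (by omega), if_neg (by omega)]

/-- The span has dimension `p + 1` and lies in its own `b₁`-orthogonal, which `p` independent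
functionals already cut down to dimension `p + 1`. -/
theorem mem_span_of_forall_apply_eq_zero (h : IsKernelFamily b₁ b₂ e s) (h₁ : b₁.IsAlt)
    (h₂ : b₂.IsAlt) (hdim : Module.finrank ℝ V = 2 * p + 1) {x : V}
    (hx : ∀ j, b₁ (e j) x = 0) : x ∈ Submodule.span ℝ (range e) := by
  obtain ⟨c, hec, -⟩ := h.exists_isotropic_dual h₁ h₂
  let φ : V →ₗ[ℝ] (Fin p → ℝ) := LinearMap.pi fun j => b₁ (e (Fin.castSucc j))
  have hφ : LinearMap.range φ = ⊤ := by
    rw [LinearMap.range_eq_top]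
    intro a
    refine ⟨∑ l, a l • c l, ?_⟩
    ext j
    simp [φ, hec]
  have h1 := LinearMap.finrank_range_add_finrank_ker φ
  rw [hφ, finrank_top, Module.finrank_fin_fun] at h1
  have hle : Submodule.span ℝ (range e) ≤ LinearMap.ker φ := by
    rw [Submodule.span_le]
    rintro _ ⟨i, rfl⟩
    rw [SetLike.mem_coe, LinearMap.mem_ker]
    ext j
    exact h.isotropic h₁ h₂ _ _
  have heq : Submodule.span ℝ (range e) = LinearMap.ker φ := by
    apply Submodule.eq_of_le_of_finrank_le hle
    rw [finrank_span_eq_card h.linearIndependent, Fintype.card_fin]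
    omega
  rw [heq, LinearMap.mem_ker]
  ext j
  exact hx _

/-- The `P`-component of `e j` is again in the kernel of `s j • b₁ + b₂`, so it is zero or spans the
line of `e j`. In the second case this form has a one-dimensional kernel on `P`, making `P`
odd-dimensional. So every `e j` is in `Q`; then `P` is orthogonal to their span, hence contained in
it, hence in `Q`. -/
theorem eq_bot_of_even_finrank (h : IsKernelFamily b₁ b₂ e s) (h₁ : b₁.IsAlt)
    (h₂ : b₂.IsAlt) (hdim : Module.finrank ℝ V = 2 * p + 1) {P Q : Submodule ℝ V}
    (hPQ : IsCompl P Q)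
    (hort : ∀ x ∈ P, ∀ y ∈ Q, b₁ x y = 0 ∧ b₂ x y = 0)
    (hP : Even (Module.finrank ℝ P)) : P = ⊥ := by
  have heQ : ∀ j, e j ∈ Q := by
    intro j
    obtain ⟨x, hx, y, hy, hxy⟩ := Submodule.mem_sup.1
      (hPQ.sup_eq_top ▸ Submodule.mem_top : e j ∈ P ⊔ Q)
    let b := s j • b₁ + b₂
    have hb : b.IsAlt := fun z => by simp [b, h₁.self_eq_zero, h₂.self_eq_zero]
    have hbe : b (e j) = 0 := by simp [b, h.snd_apply]
    have hbort : ∀ x ∈ P, ∀ y ∈ Q, b x y = 0 := fun x hx y hy => by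
      simp [b, (hort x hx y hy).1, (hort x hx y hy).2]
    have hbx : b x = 0 := by
      ext z
      obtain ⟨z₁, hz₁, z₂, hz₂, rfl⟩ := Submodule.mem_sup.1
        (hPQ.sup_eq_top ▸ Submodule.mem_top : z ∈ P ⊔ Q)
      have h3 : b y z₁ = 0 := by rw [← hb.neg_eq, hbort _ hz₁ _ hy, neg_zero]
      have h4 : b (x + y) z₁ = 0 := by rw [hxy, hbe]; rfl
      rw [map_add, LinearMap.add_apply, h3, add_zero] at h4
      simp [h4, hbort x hx z₂ hz₂]
    obtain ⟨a, ha⟩ := h.eq_smul j x hbx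
    by_cases ha0 : a = 0
    · rw [ha0, zero_smul] at ha
      rw [← hxy, ha, zero_add]; exact hy
    exfalso
    have hej : e j ∈ P := by
      have : e j = a⁻¹ • x := by rw [ha, smul_smul, inv_mul_cancel₀ ha0, one_smul]
      rw [this]; exact P.smul_mem _ hx
    obtain ⟨r, hr, hr'⟩ := LinearMap.BilinForm.IsAlt.exists_finrank_eq_add
      (b := b.restrict P) (fun z => hb z)
    have hker : LinearMap.ker (b.restrict P) = Submodule.span ℝ {⟨e j, hej⟩} := by
      apply le_antisymm
      · intro z hz
        have hbz : b z = 0 := by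
          ext t
          obtain ⟨z₁, hz₁, z₂, hz₂, rfl⟩ := Submodule.mem_sup.1
            (hPQ.sup_eq_top ▸ Submodule.mem_top : t ∈ P ⊔ Q)
          have h3 : b z z₁ = 0 := congrArg (fun f => f ⟨z₁, hz₁⟩) (LinearMap.mem_ker.1 hz)
          simp [h3, hbort z z.2 z₂ hz₂]
        obtain ⟨d, hd⟩ := h.eq_smul j z hbz
        exact Submodule.mem_span_singleton.2 ⟨d, Subtype.ext hd.symm⟩
      · rw [Submodule.span_singleton_le_iff_mem, LinearMap.mem_ker]
        ext z
        exact congrArg (fun f => f (z : V)) hbe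
    have hne : (⟨e j, hej⟩ : P) ≠ 0 := fun h0 =>
      h.linearIndependent.ne_zero j (congrArg Subtype.val h0)
    rw [hker, finrank_span_singleton hne] at hr'
    rw [hr'] at hP
    exact (Nat.even_add_one.1 hP) hr
  rw [Submodule.eq_bot_iff]
  intro x hx
  have hxQ : x ∈ Q := by
    refine (Submodule.span_le.2 ?_) (h.mem_span_of_forall_apply_eq_zero h₁ h₂ hdim (x := x) ?_)
    · rintro _ ⟨j, rfl⟩; exact heQ j
    · intro j
      rw [← h₁.neg_eq, (hort x hx _ (heQ j)).1, neg_zero]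
  simpa using hPQ.disjoint.le_bot ⟨hx, hxQ⟩

theorem isIndecomposablePair (h : IsKernelFamily b₁ b₂ e s) (h₁ : b₁.IsAlt)
    (h₂ : b₂.IsAlt) (hdim : Module.finrank ℝ V = 2 * p + 1) :
    IsIndecomposablePair b₁ b₂ := by
  refine ⟨⟨e 0, 0, h.linearIndependent.ne_zero 0⟩, fun P Q hPQ hort => ?_⟩
  have hadd := Submodule.finrank_add_eq_of_isCompl hPQ
  rcases Nat.even_or_odd (Module.finrank ℝ P) with hP | hP
  · exact Or.inl (h.eq_bot_of_even_finrank h₁ h₂ hdim hPQ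
      (fun x hx y hy => ⟨(hort x hx y hy).1, (hort x hx y hy).2.2.1⟩) hP)
  · refine Or.inr (h.eq_bot_of_even_finrank h₁ h₂ hdim hPQ.symm
      (fun y hy x hx => ⟨(hort x hx y hy).2.1, (hort x hx y hy).2.2.2⟩) ?_)
    rw [Nat.even_iff]
    rw [Nat.odd_iff] at hP
    omega

end IsKernelFamily

/-- A pair of alternating forms for which the kernels of the members of corank at most one of the
pencil span a subspace of at least half the dimension is an indecomposable Kronecker pair. -/
theorem isKroneckerPair_of_finrank_le {b₁ b₂ : LinearMap.BilinForm ℝ V} (h₁ : b₁.IsAlt)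
    (h₂ : b₂.IsAlt) (hV : Module.finrank ℝ V ≠ 0) (G : Set ℝ)
    (hG : ∀ s ∈ G, Module.finrank ℝ (LinearMap.ker (s • b₁ + b₂)) ≤ 1)
    (hspan : Module.finrank ℝ V ≤
      2 * Module.finrank ℝ (Submodule.span ℝ {x : V | ∃ s ∈ G, s • b₁ x + b₂ x = 0})) :
    Odd (Module.finrank ℝ V) ∧ IsKroneckerPair (Module.finrank ℝ V) b₁ b₂ ∧
      IsIndecomposablePair b₁ b₂ := by
  have halt : ∀ s : ℝ, (s • b₁ + b₂).IsAlt := fun s z => by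
    simp [h₁.self_eq_zero, h₂.self_eq_zero]
  obtain ⟨r, f, hfmem, hfli, hr⟩ : ∃ (r : ℕ) (f : Fin r → V),
      (∀ i, ∃ s ∈ G, s • b₁ (f i) + b₂ (f i) = 0) ∧ LinearIndependent ℝ f ∧
        Module.finrank ℝ V ≤ 2 * r := by
    obtain ⟨f, hfmem, -, hfli⟩ :=
      Submodule.exists_fun_fin_finrank_span_eq ℝ {x : V | ∃ s ∈ G, s • b₁ x + b₂ x = 0}
    exact ⟨_, f, hfmem, hfli, hspan⟩
  choose t htG ht using hfmem
  have hker : ∀ i x, t i • b₁ x + b₂ x = 0 → ∃ c : ℝ, x = c • f i := by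
    intro i x hx
    obtain ⟨z, hz⟩ := finrank_le_one_iff.1 (hG _ (htG i))
    obtain ⟨a, ha⟩ := hz ⟨x, hx⟩
    obtain ⟨d, hd⟩ := hz ⟨f i, ht i⟩
    have ha' : a • (z : V) = x := congrArg Subtype.val ha
    have hd' : d • (z : V) = f i := congrArg Subtype.val hd
    have hd0 : d ≠ 0 := by
      rintro rfl
      exact hfli.ne_zero i (by rw [← hd', zero_smul])
    exact ⟨a / d, by rw [← ha', ← hd', smul_smul, div_mul_cancel₀ _ hd0]⟩
  have hr0 : 0 < r := by omega
  have hodd : Odd (Module.finrank ℝ V) := by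
    obtain ⟨q, hq, hq'⟩ := (halt (t ⟨0, hr0⟩)).exists_finrank_eq_add
    have h1 := hG _ (htG ⟨0, hr0⟩)
    have h2 : Module.finrank ℝ (LinearMap.ker (t ⟨0, hr0⟩ • b₁ + b₂)) ≠ 0 := by
      rw [Submodule.finrank_eq_zero.ne, Submodule.ne_bot_iff]
      exact ⟨_, ht ⟨0, hr0⟩, hfli.ne_zero _⟩
    rw [hq', show Module.finrank ℝ (LinearMap.ker (t ⟨0, hr0⟩ • b₁ + b₂)) = 1 by omega]
    exact hq.add_one
  obtain ⟨p, hp⟩ := hodd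
  have hpr : p + 1 ≤ r := by omega
  have hfam : IsKernelFamily b₁ b₂ (fun i : Fin (p + 1) => f (Fin.castLE hpr i))
      (fun i => t (Fin.castLE hpr i)) := by
    refine ⟨hfli.comp _ (Fin.castLE_injective hpr), ?_, ?_, fun i x hx => hker _ x hx⟩
    · intro i j hij
      simp only at hij
      -- Equal parameters would put two independent vectors into one kernel line.
      obtain ⟨c, hc⟩ := hker (Fin.castLE hpr i) (f (Fin.castLE hpr j)) (by rw [hij]; exact ht _)
      by_contra hne
      have hne' : Fin.castLE hpr i ≠ Fin.castLE hpr j := fun h' =>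
        hne (Fin.castLE_injective hpr h')
      have h2 := @hfli (Finsupp.single (Fin.castLE hpr j) 1) (Finsupp.single (Fin.castLE hpr i) c)
        (by simp [hc])
      have h3 := DFunLike.congr_fun h2 (Fin.castLE hpr j)
      simp [hne] at h3
    · intro i
      exact eq_neg_of_add_eq_zero_right (ht _)
  -- No coefficient of the relation is zero, so rescaling `e i` by `c i` makes all coefficients one.
  obtain ⟨c, hc, j, hj⟩ := hfam.exists_sum_smul_eq_zero h₁ h₂ (by rw [Fintype.card_fin]; omega)
  have hc0 : ∀ i, c i ≠ 0 := fun i hi => hj (hfam.eq_zero_of_sum_smul_eq_zero hc hi j)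
  have hfam' := hfam.smul hc0
  refine ⟨⟨p, hp⟩, ?_, hfam'.isIndecomposablePair h₁ h₂ hp⟩
  rw [hp]
  exact hfam'.isKroneckerPair h₁ h₂ (by simpa using hc) hp

end KroneckerPairs

/-! ### Smoothness of superposition operators on spaces of continuous maps. -/

section Superposition

universe u

variable {K : Type*} [TopologicalSpace K] [CompactSpace K]
variable {E F : Type u} [NormedAddCommGroup E] [NormedSpace ℝ E]
  [NormedAddCommGroup F] [NormedSpace ℝ F]

/-- The superposition operator `γ ↦ f ∘ γ` on spaces of continuous maps. -/
def superposition (K : Type*) [TopologicalSpace K] {E F : Type u} [TopologicalSpace E]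
    [TopologicalSpace F] (f : E → F) (hf : Continuous f) (γ : C(K, E)) : C(K, F) :=
  (⟨f, hf⟩ : C(E, F)).comp γ

/-- Pointwise application of a continuous family of linear maps to a continuous function. -/
noncomputable def ContinuousMap.pointwiseApply (K : Type*) [TopologicalSpace K] [CompactSpace K]
    (E F : Type u) [NormedAddCommGroup E] [NormedSpace ℝ E] [NormedAddCommGroup F]
    [NormedSpace ℝ F] : C(K, E →L[ℝ] F) →L[ℝ] C(K, E) →L[ℝ] C(K, F) :=
  LinearMap.mkContinuous₂
    (LinearMap.mk₂ ℝ (fun (A : C(K, E →L[ℝ] F)) (h : C(K, E)) => (⟨fun k => A k (h k), by fun_prop⟩ : C(K, F)))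
      (by intros; ext; simp) (by intros; ext; simp) (by intros; ext; simp) (by intros; ext; simp))
    1 (by
      intro A h
      rw [one_mul, ContinuousMap.norm_le _ (by positivity)]
      intro k
      exact ((A k).le_opNorm (h k)).trans
        (mul_le_mul (A.norm_coe_le_norm k) (h.norm_coe_le_norm k) (norm_nonneg _) (by positivity)))

/-- Composition with `f'` is continuous in the sup norm, so the pointwise mean value inequality
gives a remainder bound uniform over `K`. -/
theorem hasFDerivAt_superposition {f : E → F} {f' : E → E →L[ℝ] F} (hf' : Continuous f')
    (h : ∀ x, HasFDerivAt f (f' x) x) (hf : Continuous f) (γ : C(K, E)) :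
    HasFDerivAt (superposition K f hf)
      (ContinuousMap.pointwiseApply K E F (superposition K f' hf' γ)) γ := by
  have hcont : Continuous (superposition K f' hf') := ContinuousMap.continuous_postcomp _
  rw [hasFDerivAt_iff_isLittleO_nhds_zero, Asymptotics.isLittleO_iff]
  intro c hc
  have hev : ∀ᶠ η in 𝓝 γ, dist (superposition K f' hf' η) (superposition K f' hf' γ) < c :=
    Metric.tendsto_nhds.1 (hcont.tendsto γ) c hc
  obtain ⟨δ, hδ, hball⟩ := Metric.eventually_nhds_iff.1 hev
  filter_upwards [Metric.ball_mem_nhds (0 : C(K, E)) hδ] with η hη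
  rw [mem_ball_zero_iff] at hη
  rw [ContinuousMap.norm_le _ (by positivity)]
  intro k
  have hseg : ∀ y ∈ segment ℝ (γ k) (γ k + η k), ‖f' y - f' (γ k)‖ ≤ c := by
    rintro y hy
    rw [segment_eq_image'] at hy
    obtain ⟨t, ht, rfl⟩ := hy
    have hd : dist (γ + t • η) γ < δ := by
      rw [dist_eq_norm, add_sub_cancel_left, norm_smul, Real.norm_eq_abs, abs_of_nonneg ht.1]
      exact (mul_le_of_le_one_left (norm_nonneg _) ht.2).trans_lt hη
    have h1 := (ContinuousMap.dist_apply_le_dist (f := superposition K f' hf' (γ + t • η))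
      (g := superposition K f' hf' γ) k).trans (hball hd).le
    rw [dist_eq_norm] at h1
    simpa [superposition] using h1
  have hmv := (convex_segment (γ k) (γ k + η k)).norm_image_sub_le_of_norm_hasFDerivWithin_le'
    (fun y _ => (h y).hasFDerivWithinAt) hseg (left_mem_segment ℝ _ _) (right_mem_segment ℝ _ _)
  rw [add_sub_cancel_left] at hmv
  refine (le_of_eq_of_le ?_ hmv).trans
    (mul_le_mul_of_nonneg_left (η.norm_coe_le_norm k) hc.le)
  rfl

/-- The derivative is a fixed continuous linear map applied to the superposition operator of `fderiv
ℝ f`. The induction therefore replaces `F` by `E →L[ℝ] F`, which is why `E` and `F` share a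
universe. -/
theorem contDiff_superposition {f : E → F} (h : ContDiff ℝ ∞ f) :
    ContDiff ℝ ∞ (superposition K f h.continuous) := by
  rw [contDiff_infty]
  intro n
  induction n generalizing F with
  | zero =>
    exact contDiff_zero.2 (ContinuousMap.continuous_postcomp _)
  | succ n ih =>
    have hfd : ContDiff ℝ ∞ (fderiv ℝ f) := h.fderiv_right (by simp)
    exact contDiff_succ_iff_hasFDerivAt.2
      ⟨fun γ => ContinuousMap.pointwiseApply K E F (superposition K _ hfd.continuous γ),
        ContDiff.comp (g := ContinuousMap.pointwiseApply K E F)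
          (ContinuousLinearMap.contDiff _) (ih hfd),
        fun γ => hasFDerivAt_superposition hfd.continuous
          (fun x => (h.differentiable (by simp) x).hasFDerivAt) h.continuous γ⟩

end Superposition

/-! ### Means and primitives on the unit interval as continuous linear maps. -/

section UnitIntervalIntegral

open MeasureTheory
open scoped unitInterval

variable {E : Type*} [NormedAddCommGroup E] [NormedSpace ℝ E]

theorem ContinuousMap.integrable_unitInterval (γ : C(I, E)) : Integrable γ :=
  γ.continuous.integrable_of_hasCompactSupport (HasCompactSupport.of_compactSpace _)

theorem ContinuousMap.norm_integral_unitInterval_le (γ : C(I, E)) : ‖∫ r, γ r‖ ≤ ‖γ‖ := by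
  simpa using norm_integral_le_of_norm_le_const (μ := (volume : Measure I))
    (Eventually.of_forall fun r => γ.norm_coe_le_norm r)

/-- The mean value of a continuous function on the unit interval. -/
noncomputable def unitIntervalMean (E : Type*) [NormedAddCommGroup E] [NormedSpace ℝ E] :
    C(I, E) →L[ℝ] E :=
  LinearMap.mkContinuous
    { toFun := fun γ => ∫ r, γ r
      map_add' := fun γ η => integral_add γ.integrable_unitInterval η.integrable_unitInterval
      map_smul' := fun c γ => integral_smul c _ } 1
    (fun γ => by simpa using γ.norm_integral_unitInterval_le)

/-- Precomposition of a function on the unit interval with the multiplication by `s`. -/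
def ContinuousMap.rescale (s : I) (γ : C(I, E)) : C(I, E) :=
  γ.comp ⟨fun r => s * r, by fun_prop⟩

/-- The primitive `s ↦ ∫₀ˢ γ` of a continuous function on the unit interval. -/
noncomputable def unitIntervalPrimitive (E : Type*) [NormedAddCommGroup E] [NormedSpace ℝ E] :
    C(I, E) →L[ℝ] C(I, E) :=
  LinearMap.mkContinuous
    { toFun := fun γ => ⟨fun s => (s : ℝ) • unitIntervalMean E (γ.rescale s), by
        refine continuous_subtype_val.smul ((unitIntervalMean E).continuous.comp ?_)
        exact ContinuousMap.continuous_of_continuous_uncurry _ (by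
          change Continuous fun p : I × I => γ (p.1 * p.2)
          fun_prop)⟩
      map_add' := fun γ η => by
        ext s
        change (s : ℝ) • unitIntervalMean E (γ.rescale s + η.rescale s) = _
        rw [map_add, smul_add]; rfl
      map_smul' := fun c γ => by
        ext s
        change (s : ℝ) • unitIntervalMean E (c • γ.rescale s) = _
        rw [map_smul, smul_comm]; rfl } 1
    (fun γ => by
      rw [one_mul, ContinuousMap.norm_le _ (norm_nonneg _)]
      intro s
      change ‖(s : ℝ) • unitIntervalMean E (γ.rescale s)‖ ≤ _
      rw [norm_smul, Real.norm_eq_abs, abs_of_nonneg s.2.1]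
      refine (mul_le_of_le_one_left (norm_nonneg _) s.2.2).trans ?_
      refine (ContinuousMap.norm_integral_unitInterval_le _).trans ?_
      rw [ContinuousMap.norm_le _ (norm_nonneg _)]
      exact fun r => γ.norm_coe_le_norm _)

theorem unitIntervalPrimitive_apply (γ : C(I, E)) (s : I) :
    unitIntervalPrimitive E γ s = (s : ℝ) • unitIntervalMean E (γ.rescale s) := rfl

theorem norm_unitIntervalPrimitive_le (γ : C(I, E)) : ‖unitIntervalPrimitive E γ‖ ≤ ‖γ‖ := by
  simpa using (LinearMap.mkContinuous_norm_le _ zero_le_one _ |> fun h =>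
    (unitIntervalPrimitive E).le_of_opNorm_le h γ)

theorem integral_unitInterval_eq (f : ℝ → E) : ∫ r : I, f r = ∫ r in (0 : ℝ)..1, f r := by
  rw [intervalIntegral.integral_of_le zero_le_one, ← integral_Icc_eq_integral_Ioc]
  exact integral_subtype measurableSet_Icc f

end UnitIntervalIntegral

/-! ### Hadamard's lemma and smooth local flows. -/

section Flow

open MeasureTheory
open scoped unitInterval

universe u

variable {E : Type u} [NormedAddCommGroup E] [NormedSpace ℝ E]

/-- The embedding of `E` into the continuous functions as the constant functions. -/
noncomputable def unitIntervalConst (E : Type*) [NormedAddCommGroup E] [NormedSpace ℝ E] :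
    E →L[ℝ] C(I, E) :=
  LinearMap.mkContinuous
    { toFun := fun x => ContinuousMap.const I x
      map_add' := fun _ _ => rfl
      map_smul' := fun _ _ => rfl } 1
    (fun x => by
      rw [one_mul, ContinuousMap.norm_le _ (norm_nonneg _)]
      exact fun _ => le_rfl)

theorem unitIntervalConst_apply (x : E) (r : I) : unitIntervalConst E x r = x := rfl

theorem unitIntervalPrimitive_const_apply [CompleteSpace E] (x : E) (r : I) :
    unitIntervalPrimitive E (unitIntervalConst E x) r = (r : ℝ) • x := by
  rw [unitIntervalPrimitive_apply]
  congr 1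
  change ∫ _ : I, x = x
  simp

/-- **Hadamard's lemma**. -/
theorem exists_contDiff_sub_eq_apply_sub [CompleteSpace E] {f : E → ℝ} (hf : ContDiff ℝ ∞ f)
    (a : E) :
    ∃ g : E → E →L[ℝ] ℝ, ContDiff ℝ ∞ g ∧ (∀ x, f x - f a = g x (x - a)) ∧
      g a = fderiv ℝ f a := by
  have hfd : ContDiff ℝ ∞ (fderiv ℝ f) := hf.fderiv_right (by simp)
  -- The segment from `a` to `x`, as a smooth function of `x`; `g` is the mean of `fderiv ℝ f` along
  -- it.
  let line : E → C(I, E) := fun x =>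
    unitIntervalConst E a + unitIntervalPrimitive E (unitIntervalConst E (x - a))
  have hline : ∀ x (r : I), line x r = a + (r : ℝ) • (x - a) := by
    intro x r
    simp only [line, ContinuousMap.add_apply, unitIntervalConst_apply,
      unitIntervalPrimitive_const_apply]
  have hlinec : ContDiff ℝ ∞ line := by fun_prop
  have hg : ∀ x, unitIntervalMean (E →L[ℝ] ℝ) (superposition I (fderiv ℝ f) hfd.continuous (line x))
      = ∫ r : I, fderiv ℝ f (a + (r : ℝ) • (x - a)) := by
    intro x
    change ∫ r : I, fderiv ℝ f (line x r) = _
    simp only [hline]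
  refine ⟨fun x => unitIntervalMean (E →L[ℝ] ℝ)
    (superposition I (fderiv ℝ f) hfd.continuous (line x)), ?_, ?_, ?_⟩
  · exact (unitIntervalMean (E →L[ℝ] ℝ)).contDiff.comp ((contDiff_superposition hfd).comp hlinec)
  · intro x
    simp only [hg]
    rw [integral_unitInterval_eq (fun r => fderiv ℝ f (a + r • (x - a))),
      ContinuousLinearMap.intervalIntegral_apply]
    · have := intervalIntegral.integral_eq_sub_of_hasDerivAt (a := 0) (b := 1)
        (f := fun r : ℝ => f (a + r • (x - a)))
        (f' := fun r : ℝ => fderiv ℝ f (a + r • (x - a)) (x - a)) ?_ ?_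
      · rw [this]; simp
      · intro r _
        have h1 : HasDerivAt (fun r : ℝ => a + r • (x - a)) (x - a) r := by
          simpa using ((hasDerivAt_id r).smul_const (x - a)).const_add a
        exact (hf.differentiable (by simp) _).hasFDerivAt.comp_hasDerivAt r h1
      · apply Continuous.intervalIntegrable
        have := hfd.continuous
        fun_prop
    · apply Continuous.intervalIntegrable
      have := hfd.continuous
      fun_prop
  · simp [hg]

/-- A fixed point depending on a parameter is a smooth function of it if the map is smooth, fixed
points are unique, and the derivative of the map in the space variable is less than one. -/
theorem contDiffAt_of_forall_fixedPoint {P Y : Type*} [NormedAddCommGroup P] [NormedSpace ℝ P]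
    [CompleteSpace P] [NormedAddCommGroup Y] [NormedSpace ℝ Y] [CompleteSpace Y]
    {T : P × Y → Y} (hT : ContDiff ℝ ∞ T) {y : P → Y} {s : Set P} (hs : IsOpen s)
    (hy : ∀ p ∈ s, ∀ z, T (p, z) = z ↔ z = y p) {p : P} (hp : p ∈ s) {c : NNReal} (hc : c < 1)
    (hlip : LipschitzWith c fun z => T (p, z)) : ContDiffAt ℝ ∞ y p := by
  let f : P × Y → Y := fun q => q.2 - T q
  have hf : ContDiff ℝ ∞ f := contDiff_snd.sub hT
  have hfy : ∀ p ∈ s, f (p, y p) = 0 := fun p hp => sub_eq_zero.2 ((hy p hp _).2 rfl).symm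
  -- The partial derivative is `1 - D` with `‖D‖ < 1`, invertible by the Neumann series.
  have hinv : (fderiv ℝ f (p, y p) ∘L .inr ℝ P Y).IsInvertible := by
    let D := fderiv ℝ T (p, y p) ∘L .inr ℝ P Y
    have hTD : HasFDerivAt (fun z => T (p, z)) D (y p) :=
      (hT.differentiable (by simp) _).hasFDerivAt.comp (y p) (hasFDerivAt_prodMk_right p (y p))
    have hD : ‖D‖ < 1 := (hTD.le_of_lipschitz hlip).trans_lt hc
    have hfD : fderiv ℝ f (p, y p) ∘L .inr ℝ P Y = 1 - D := by
      have h1 : HasFDerivAt f (.snd ℝ P Y - fderiv ℝ T (p, y p)) (p, y p) :=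
        hasFDerivAt_snd.sub (hT.differentiable (by simp) _).hasFDerivAt
      rw [h1.fderiv]
      ext z
      simp [D]
    rw [hfD]
    exact ⟨ContinuousLinearEquiv.unitsEquiv ℝ Y (Units.oneSub D hD), rfl⟩
  have hcd : ContDiffAt ℝ ∞ f (p, y p) := hf.contDiffAt
  have hψ := hcd.contDiffAt_implicitFunction (by simp) hinv
  refine hψ.congr_of_eventuallyEq ?_
  filter_upwards [hcd.eventually_apply_implicitFunction (by simp) hinv, hs.mem_nhds hp] with q hq hqs
  rw [hfy p hp] at hq
  exact ((hy q hqs _).1 (sub_eq_zero.1 hq).symm).symm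

/-- A compactly supported smooth vector field has a smooth local flow. -/
theorem exists_contDiffOn_flow [FiniteDimensional ℝ E] {X : E → E} (hX : ContDiff ℝ ∞ X)
    (hsupp : HasCompactSupport X) :
    ∃ δ > 0, ∃ φ : ℝ × E → E, ContDiffOn ℝ ∞ φ (Ioo (-δ) δ ×ˢ univ) ∧ (∀ x, φ (0, x) = x) ∧
      ∀ t ∈ Ioo (-δ) δ, ∀ x, HasDerivAt (fun t => φ (t, x)) (X (φ (t, x))) t := by
  obtain ⟨K, hK⟩ := hX.lipschitzWith_of_hasCompactSupport hsupp (by simp)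
  have hS := contDiff_superposition (K := I) hX
  set S := superposition I X hX.continuous with hSdef
  have hSK : LipschitzWith K S := by
    refine LipschitzWith.of_dist_le_mul fun γ η => ?_
    rw [ContinuousMap.dist_le (by positivity)]
    intro r
    exact (hK.dist_le_mul _ _).trans
      (mul_le_mul_of_nonneg_left (ContinuousMap.dist_apply_le_dist r) K.2)
  -- Time is rescaled: the path `r ↦ φ (r * t, x)` on the unit interval is a fixed point of `γ ↦ x +
  -- t ∫₀ʳ X(γ)`, so all times share one space of paths and `t` becomes a smooth parameter.
  let T : (ℝ × E) × C(I, E) → C(I, E) := fun q =>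
    unitIntervalConst E q.1.2 + q.1.1 • unitIntervalPrimitive E (S q.2)
  have hT : ContDiff ℝ ∞ T := by fun_prop
  have hlip : ∀ p : ℝ × E, LipschitzWith (‖p.1‖₊ * K) fun z => T (p, z) := by
    intro p
    refine LipschitzWith.of_dist_le_mul fun γ η => ?_
    simp only [T, dist_add_left, NNReal.coe_mul, coe_nnnorm, mul_assoc]
    rw [dist_eq_norm, ← smul_sub, norm_smul, ← map_sub]
    refine mul_le_mul_of_nonneg_left ?_ (norm_nonneg p.1)
    refine le_trans ?_ (hSK.dist_le_mul γ η)
    rw [dist_eq_norm]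
    exact norm_unitIntervalPrimitive_le _
  let δ : ℝ := (K + 1 : ℝ)⁻¹
  have hδ : 0 < δ := by positivity
  let s : Set (ℝ × E) := Ioo (-δ) δ ×ˢ univ
  have hs : IsOpen s := isOpen_Ioo.prod isOpen_univ
  have hcontr : ∀ p ∈ s, ‖p.1‖₊ * K < 1 := by
    intro p hp
    have h1 : |p.1| < δ := abs_lt.2 hp.1
    rw [← NNReal.coe_lt_coe, NNReal.coe_mul, coe_nnnorm, Real.norm_eq_abs, NNReal.coe_one]
    have hK0 : (0 : ℝ) ≤ K := K.2
    calc |p.1| * K ≤ |p.1| * (K + 1) := by gcongr; linarith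
      _ < δ * (K + 1) := by gcongr
      _ = 1 := inv_mul_cancel₀ (by positivity)
  have hex : ∀ p : ℝ × E, ∃ z : C(I, E), p ∈ s → ∀ w, T (p, w) = w ↔ w = z := by
    intro p
    by_cases hp : p ∈ s
    · have hc : ContractingWith (‖p.1‖₊ * K) fun z => T (p, z) := ⟨hcontr p hp, hlip p⟩
      refine ⟨hc.fixedPoint, fun _ w => ⟨fun hw => hc.fixedPoint_unique hw, ?_⟩⟩
      rintro rfl
      exact hc.fixedPoint_isFixedPt
    · exact ⟨0, fun h => absurd h hp⟩
  choose y hy using hex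
  have hyT : ∀ p ∈ s, T (p, y p) = y p := fun p hp => (hy p hp _).2 rfl
  have hysm : ∀ p ∈ s, ContDiffAt ℝ ∞ y p := fun p hp =>
    contDiffAt_of_forall_fixedPoint hT hs (fun q hq => hy q hq) hp (hcontr p hp) (hlip p)
  let φ : ℝ × E → E := fun p => ContinuousMap.evalCLM ℝ (1 : I) (y p)
  have hφ : ∀ p ∈ s, ContDiffAt ℝ ∞ φ p := fun p hp =>
    (ContinuousMap.evalCLM ℝ (1 : I) : C(I, E) →L[ℝ] E).contDiff.contDiffAt.comp p (hysm p hp)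
  -- The initial part of a solution, stretched to the unit interval, solves the problem for the
  -- shorter time; uniqueness identifies the two.
  have hscale : ∀ p ∈ s, ∀ r : I, ((r : ℝ) * p.1, p.2) ∈ s ∧ y p r = φ ((r : ℝ) * p.1, p.2) := by
    intro p hp r
    have hrs : ((r : ℝ) * p.1, p.2) ∈ s := by
      refine ⟨abs_lt.1 ?_, mem_univ _⟩
      change |(r : ℝ) * p.1| < δ
      rw [abs_mul, abs_of_nonneg r.2.1]
      exact (mul_le_of_le_one_left (abs_nonneg _) r.2.2).trans_lt (abs_lt.2 hp.1)
    refine ⟨hrs, ?_⟩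
    have h1 : (y p).rescale r = y ((r : ℝ) * p.1, p.2) := by
      rw [← hy _ hrs]
      ext q
      have h2 : (y p).rescale r q = T (p, y p) (r * q) := by rw [hyT p hp]; rfl
      rw [h2]
      simp only [T, ContinuousMap.add_apply, ContinuousMap.smul_apply, unitIntervalConst_apply,
        unitIntervalPrimitive_apply]
      have h3 : (S ((y p).rescale r)).rescale q = (S (y p)).rescale (r * q) := by
        ext r'
        change X (y p (r * (q * r'))) = X (y p (r * q * r'))
        rw [mul_assoc]
      rw [h3, smul_smul, smul_smul]
      congr 2
      push_cast
      ring
    change _ = y ((r : ℝ) * p.1, p.2) 1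
    rw [← h1]
    change _ = y p (r * 1)
    rw [mul_one]
  have hint : ∀ t ∈ Ioo (-δ) δ, ∀ x, φ (t, x) = x + ∫ r in (0 : ℝ)..t, X (φ (r, x)) := by
    intro t ht x
    have hp : (t, x) ∈ s := ⟨ht, mem_univ _⟩
    have h1 : φ (t, x) = T ((t, x), y (t, x)) 1 := by rw [hyT _ hp]; rfl
    have h2 : unitIntervalMean E ((S (y (t, x))).rescale 1) = ∫ r : I, X (φ (t * r, x)) := by
      change ∫ r : I, X (y (t, x) (1 * r)) = _
      congr 1
      ext r
      rw [one_mul, (hscale _ hp r).2, mul_comm]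
    rw [h1]
    simp only [T, ContinuousMap.add_apply, ContinuousMap.smul_apply, unitIntervalConst_apply,
      unitIntervalPrimitive_apply]
    rw [h2, integral_unitInterval_eq (fun r => X (φ (t * r, x))),
      Set.Icc.coe_one, one_smul, intervalIntegral.smul_integral_comp_mul_left (fun r => X (φ (r, x)))]
    simp
  have hcont : ∀ x, ContinuousOn (fun r => X (φ (r, x))) (Ioo (-δ) δ) := by
    intro x r hr
    have h1 : ContinuousAt (fun r => φ (r, x)) r :=
      (hφ (r, x) ⟨hr, mem_univ _⟩).continuousAt.comp (f := fun r => (r, x)) (by fun_prop)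
    exact (hX.continuous.continuousAt.comp h1).continuousWithinAt
  refine ⟨δ, hδ, φ, fun p hp => (hφ p hp).contDiffWithinAt, ?_, ?_⟩
  · intro x
    rw [hint 0 ⟨by linarith, hδ⟩]
    simp
  · intro t ht x
    have hsub : uIcc 0 t ⊆ Ioo (-δ) δ :=
      (ordConnected_Ioo).uIcc_subset ⟨by linarith, hδ⟩ ht
    have h1 := intervalIntegral.integral_hasDerivAt_right
      ((hcont x).mono hsub).intervalIntegrable
      ((hcont x).stronglyMeasurableAtFilter isOpen_Ioo t ht)
      ((hcont x).continuousAt (isOpen_Ioo.mem_nhds ht))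
    refine (h1.const_add x).congr_of_eventuallyEq ?_
    filter_upwards [isOpen_Ioo.mem_nhds ht] with r hr
    exact hint r hr x

end Flow

/-! ### Straightening a nonvanishing vector field. -/

section FlowBox

universe u

variable {E : Type u} [NormedAddCommGroup E] [NormedSpace ℝ E] [FiniteDimensional ℝ E]

theorem exists_contDiff_hasCompactSupport_eventuallyEq {F : Type*} [NormedAddCommGroup F]
    [NormedSpace ℝ F] {X : E → F} {s : Set E} (hs : IsOpen s) (hX : ContDiffOn ℝ ∞ X s) {x₀ : E}
    (hx₀ : x₀ ∈ s) :
    ∃ Y : E → F, ContDiff ℝ ∞ Y ∧ HasCompactSupport Y ∧ Y =ᶠ[𝓝 x₀] X := by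
  obtain ⟨R, hR, hRs⟩ := Metric.nhds_basis_closedBall.mem_iff.1 (hs.mem_nhds hx₀)
  let χ : ContDiffBump x₀ := ⟨R / 2, R, half_pos hR, half_lt_self hR⟩
  have htsupp : tsupport χ ⊆ s := by rw [χ.tsupport_eq]; exact hRs
  refine ⟨fun x => χ x • X x, ?_, χ.hasCompactSupport.smul_right, ?_⟩
  · rw [contDiff_iff_contDiffAt]
    intro x
    by_cases hx : x ∈ s
    · exact χ.contDiff.contDiffAt.smul ((hX x hx).contDiffAt (hs.mem_nhds hx))
    · have h0 : χ =ᶠ[𝓝 x] 0 := notMem_tsupport_iff_eventuallyEq.1 fun h => hx (htsupp h)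
      refine (contDiffAt_const (c := (0 : F))).congr_of_eventuallyEq ?_
      filter_upwards [h0] with y hy
      simp [hy]
  · filter_upwards [χ.eventuallyEq_one] with y hy
    simp [hy]

/-- Straightening of a vector field near a point where it does not vanish. -/
theorem exists_flowBox {X : E → E} {s : Set E} (hs : IsOpen s) (hX : ContDiffOn ℝ ∞ X s) {x₀ : E}
    (hx₀ : x₀ ∈ s) (hne : X x₀ ≠ 0) :
    ∃ E' : Submodule ℝ E, Module.finrank ℝ E' + 1 = Module.finrank ℝ E ∧
      ∃ Θ : OpenPartialHomeomorph (ℝ × E') E, ∃ L : ℝ × E' → (ℝ × E') ≃L[ℝ] E,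
        (0, 0) ∈ Θ.source ∧ Θ.target ⊆ s ∧
        ∀ p ∈ Θ.source, ContDiffAt ℝ ∞ Θ p ∧ ContDiffAt ℝ ∞ Θ.symm (Θ p) ∧
          HasFDerivAt Θ (L p : ℝ × E' →L[ℝ] E) p ∧
          HasFDerivAt Θ.symm ((L p).symm : E →L[ℝ] ℝ × E') (Θ p) ∧ L p (1, 0) = X (Θ p) := by
  obtain ⟨Y, hY, hYsupp, hYX⟩ := exists_contDiff_hasCompactSupport_eventuallyEq hs hX hx₀
  obtain ⟨δ, hδ, φ, hφ, hφ0, hφt⟩ := exists_contDiffOn_flow hY hYsupp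
  obtain ⟨E', hE'⟩ := Submodule.exists_isCompl (Submodule.span ℝ {X x₀})
  have hfr : Module.finrank ℝ E' + 1 = Module.finrank ℝ E := by
    rw [← Submodule.finrank_add_eq_of_isCompl hE', finrank_span_singleton hne, add_comm]
  refine ⟨E', hfr, ?_⟩
  -- Flow off a slice transversal to `X x₀`. At the origin the derivative sends `(1, 0)` to `X x₀`
  -- and is the inclusion on `E'`, hence is invertible.
  let f : ℝ × E' → E := fun p => φ (p.1, x₀ + p.2)
  have hopen : IsOpen (Ioo (-δ) δ ×ˢ (univ : Set E)) := isOpen_Ioo.prod isOpen_univ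
  have hf : ∀ p : ℝ × E', p.1 ∈ Ioo (-δ) δ → ContDiffAt ℝ ∞ f p := by
    intro p hp
    have h1 : ContDiffAt ℝ ∞ φ (p.1, x₀ + (p.2 : E)) :=
      (hφ _ ⟨hp, mem_univ _⟩).contDiffAt (hopen.mem_nhds ⟨hp, mem_univ _⟩)
    have h2 : ContDiff ℝ ∞ fun p : ℝ × E' => (p.1, x₀ + (p.2 : E)) :=
      contDiff_fst.prodMk (contDiff_const.add (E'.subtypeL.contDiff.comp contDiff_snd))
    exact h1.comp p h2.contDiffAt
  have hft : ∀ p : ℝ × E', p.1 ∈ Ioo (-δ) δ → fderiv ℝ f p (1, 0) = Y (f p) := by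
    intro p hp
    have h1 : HasFDerivAt f (fderiv ℝ f p) p := ((hf p hp).differentiableAt (by simp)).hasFDerivAt
    have h2 : HasDerivAt (fun t : ℝ => (t, p.2)) ((1 : ℝ), (0 : E')) p.1 :=
      (hasDerivAt_id p.1).prodMk (hasDerivAt_const _ _)
    exact (h1.comp_hasDerivAt p.1 h2).unique (hφt p.1 hp (x₀ + p.2))
  have h00 : (0 : ℝ) ∈ Ioo (-δ) δ := ⟨by linarith, hδ⟩
  have hf0 : f (0, 0) = x₀ := by simp [f, hφ0]
  have hfy : ∀ y : E', fderiv ℝ f (0, 0) (0, y) = y := by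
    intro y
    have h1 : HasFDerivAt f (fderiv ℝ f (0, 0)) (0, 0) :=
      ((hf (0, 0) h00).differentiableAt (by simp)).hasFDerivAt
    have h2 := h1.comp (0 : E') (hasFDerivAt_prodMk_right (𝕜 := ℝ) (0 : ℝ) (0 : E'))
    have h3 : HasFDerivAt (f ∘ fun y => ((0 : ℝ), y)) E'.subtypeL 0 := by
      have : (f ∘ fun y : E' => ((0 : ℝ), y)) = fun y => x₀ + E'.subtypeL y := by
        ext y; simp [f, hφ0]
      rw [this]
      exact E'.subtypeL.hasFDerivAt.const_add x₀
    simpa using DFunLike.congr_fun (h2.unique h3) y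
  have hL₀ : ∃ L₀ : (ℝ × E') ≃L[ℝ] E, (L₀ : ℝ × E' →L[ℝ] E) = fderiv ℝ f (0, 0) := by
    have hinj : Function.Injective (fderiv ℝ f (0, 0)) := by
      rw [injective_iff_map_eq_zero]
      rintro ⟨t, y⟩ hty
      have h1 : ((t, y) : ℝ × E') = t • ((1 : ℝ), (0 : E')) + (0, y) := by simp
      rw [h1, map_add, map_smul, hft (0, 0) h00, hfy, hf0, hYX.eq_of_nhds] at hty
      have hmem : t • X x₀ ∈ E' := by
        rw [eq_neg_of_add_eq_zero_left hty]; exact E'.neg_mem y.2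
      have h2 : t • X x₀ = 0 := by
        simpa using hE'.disjoint.le_bot
          ⟨Submodule.smul_mem _ t (Submodule.mem_span_singleton_self _), hmem⟩
      rw [h2, zero_add] at hty
      have ht : t = 0 := (smul_eq_zero.1 h2).resolve_right hne
      rw [ht, show y = 0 from Subtype.ext hty]; rfl
    refine ⟨(LinearEquiv.ofInjectiveOfFinrankEq (fderiv ℝ f (0, 0)).toLinearMap hinj
      (by simp [← hfr, add_comm])).toContinuousLinearEquiv, ?_⟩
    ext p <;> rfl
  obtain ⟨L₀, hL₀⟩ := hL₀
  have hfd0 : HasFDerivAt f (L₀ : ℝ × E' →L[ℝ] E) (0, 0) := by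
    rw [hL₀]; exact ((hf (0, 0) h00).differentiableAt (by simp)).hasFDerivAt
  let Θ₀ := (hf (0, 0) h00).toOpenPartialHomeomorph f hfd0 (by simp)
  have hev : ∀ᶠ p in 𝓝 ((0 : ℝ), (0 : E')), p.1 ∈ Ioo (-δ) δ ∧ f p ∈ s ∧ Y (f p) = X (f p) ∧
      fderiv ℝ f p ∈ range ((↑) : ((ℝ × E') ≃L[ℝ] E) → (ℝ × E' →L[ℝ] E)) := by
    have hfc : Tendsto f (𝓝 (0, 0)) (𝓝 x₀) := by
      have := (hf (0, 0) h00).continuousAt.tendsto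
      rwa [hf0] at this
    have hfdc : ContinuousAt (fderiv ℝ f) (0, 0) :=
      ((hf (0, 0) h00).fderiv_right (m := 0) (by simp)).continuousAt
    refine (continuous_fst.tendsto ((0 : ℝ), (0 : E')) |>.eventually
      (isOpen_Ioo.mem_nhds h00)).and ((hfc.eventually (hs.mem_nhds hx₀)).and
      ((hfc.eventually hYX).and ?_))
    exact hfdc.tendsto.eventually (ContinuousLinearEquiv.isOpen.mem_nhds ⟨L₀, hL₀⟩)
  obtain ⟨W, hW, hWo, hW0⟩ := eventually_nhds_iff.1 hev
  have : Nonempty ((ℝ × E') ≃L[ℝ] E) := ⟨L₀⟩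
  choose! L hL using fun p (hp : p ∈ W) => (hW p hp).2.2.2
  let Θ := Θ₀.restrOpen W hWo
  have hfΘ : ∀ p ∈ Θ.source, HasFDerivAt Θ (L p : ℝ × E' →L[ℝ] E) p := by
    intro p hp
    rw [hL p hp.2]
    exact ((hf p (hW p hp.2).1).differentiableAt (by simp)).hasFDerivAt
  refine ⟨Θ, L, ⟨(hf (0, 0) h00).mem_toOpenPartialHomeomorph_source hfd0 (by simp), hW0⟩, ?_, ?_⟩
  · intro x hx
    have h1 := Θ.map_target hx
    have h2 := (hW _ h1.2).2.1
    rwa [show f (Θ.symm x) = x from Θ.right_inv hx] at h2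
  · intro p hp
    have hΘp : ContDiffAt ℝ ∞ Θ p := hf p (hW p hp.2).1
    have htgt := Θ.map_source hp
    have hleft := Θ.left_inv hp
    refine ⟨hΘp, ?_, hfΘ p hp, ?_, ?_⟩
    · exact Θ.contDiffAt_symm (f₀' := L p) htgt (by rw [hleft]; exact hfΘ p hp)
        (by rw [hleft]; exact hΘp)
    · exact Θ.hasFDerivAt_symm (f' := L p) htgt (by rw [hleft]; exact hfΘ p hp)
    · rw [← ContinuousLinearEquiv.coe_coe, hL p hp.2, hft p (hW p hp.2).1]
      exact (hW p hp.2).2.2.1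

end FlowBox

/-! ### Involutive families and their first integrals. -/

section Frobenius

variable {E E' : Type*} [NormedAddCommGroup E] [NormedSpace ℝ E]
  [NormedAddCommGroup E'] [NormedSpace ℝ E'] {ι : Type*} [Fintype ι]

/-- A finite family of smooth vector fields on `Ω` whose Lie brackets are combinations of the
fields, with continuous structure functions. -/
structure IsInvolutiveFamily (X : ι → E → E) (c : ι → ι → ι → E → ℝ) (Ω : Set E) : Prop where
  contDiffOn : ∀ i, ContDiffOn ℝ ∞ (X i) Ω
  continuousOn : ∀ i j k, ContinuousOn (c i j k) Ω
  lieBracket_eq : ∀ i j, ∀ x ∈ Ω,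
    VectorField.lieBracket ℝ (X i) (X j) x = ∑ k, c i j k x • X k x

/-- A solution of a homogeneous linear system that vanishes at the left end vanishes. -/
theorem eq_zero_of_hasDerivAt_linear_system {T : ℝ} {u : ι → ℝ → ℝ} {a : ι → ι → ℝ → ℝ}
    (ha : ∀ i k, ContinuousOn (a i k) (Icc 0 T))
    (hu : ∀ i, ∀ t ∈ Icc 0 T, HasDerivAt (u i) (∑ k, a i k t * u k t) t)
    (hu0 : ∀ i, u i 0 = 0) : ∀ t ∈ Icc 0 T, ∀ i, u i t = 0 := by
  have hbd : ∀ i k, ∃ C, ∀ t ∈ Icc 0 T, ‖a i k t‖ ≤ C := fun i k =>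
    isCompact_Icc.exists_bound_of_continuousOn (ha i k)
  choose C hC using hbd
  intro t ht i
  have hC0 : ∀ i k, 0 ≤ C i k := fun i k => (norm_nonneg _).trans (hC i k t ht)
  have hder : ∀ t ∈ Icc 0 T,
      HasDerivAt (fun t i => u i t) (fun i => ∑ k, a i k t * u k t) t := fun t ht =>
    hasDerivAt_pi.2 fun i => hu i t ht
  have hmain := eq_zero_of_abs_deriv_le_mul_abs_self_of_eq_zero_right
    (f := fun t i => u i t) (f' := fun t i => ∑ k, a i k t * u k t) (K := ∑ i, ∑ k, C i k)
    (fun s hs => (hder s hs).continuousAt.continuousWithinAt)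
    (fun s hs => (hder s (Ico_subset_Icc_self hs)).hasDerivWithinAt)
    (funext hu0) (fun s hs => ?_) t ht
  · exact congrFun hmain i
  · have hs' := Ico_subset_Icc_self hs
    have hnn : 0 ≤ ∑ i, ∑ k, C i k :=
      Finset.sum_nonneg fun i _ => Finset.sum_nonneg fun k _ => hC0 i k
    refine (pi_norm_le_iff_of_nonneg (mul_nonneg hnn (norm_nonneg _))).2 fun j => ?_
    refine (norm_sum_le _ _).trans ?_
    have h1 : ∑ k, C j k ≤ ∑ i, ∑ k, C i k :=
      Finset.single_le_sum (f := fun i => ∑ k, C i k)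
        (fun i _ => Finset.sum_nonneg fun k _ => hC0 i k) (Finset.mem_univ j)
    refine le_trans ?_ (mul_le_mul_of_nonneg_right h1 (norm_nonneg _))
    rw [Finset.sum_mul]
    refine Finset.sum_le_sum fun k _ => ?_
    rw [norm_mul]
    exact mul_le_mul (hC j k s hs') (norm_le_pi_norm (fun i => u i s) k) (norm_nonneg _) (hC0 j k)

namespace IsInvolutiveFamily

theorem mono {X : ι → E → E} {c : ι → ι → ι → E → ℝ} {Ω Ω' : Set E}
    (h : IsInvolutiveFamily X c Ω) (hΩ : Ω' ⊆ Ω) : IsInvolutiveFamily X c Ω' :=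
  ⟨fun i => (h.contDiffOn i).mono hΩ, fun i j k => (h.continuousOn i j k).mono hΩ,
    fun i j x hx => h.lieBracket_eq i j x (hΩ hx)⟩

/-- Pulling back an involutive family by a local diffeomorphism. -/
theorem pullback [CompleteSpace E'] {X : ι → E → E} {c : ι → ι → ι → E → ℝ} {Ω : Set E}
    (h : IsInvolutiveFamily X c Ω) (hΩ : IsOpen Ω)
    (Θ : OpenPartialHomeomorph E' E) (L : E' → E' ≃L[ℝ] E) (htarget : Θ.target ⊆ Ω)
    (hΘ : ∀ p ∈ Θ.source, ContDiffAt ℝ ∞ Θ p) (hΘs : ∀ p ∈ Θ.source, ContDiffAt ℝ ∞ Θ.symm (Θ p))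
    (hL : ∀ p ∈ Θ.source, HasFDerivAt Θ (L p : E' →L[ℝ] E) p)
    (hLs : ∀ p ∈ Θ.source, HasFDerivAt Θ.symm ((L p).symm : E →L[ℝ] E') (Θ p)) :
    IsInvolutiveFamily (fun i p => (L p).symm (X i (Θ p))) (fun i j k p => c i j k (Θ p))
      Θ.source := by
  have hmem : ∀ p ∈ Θ.source, Θ p ∈ Ω := fun p hp => htarget (Θ.map_source hp)
  have hpb : ∀ (Y : E → E), ∀ p ∈ Θ.source,
      VectorField.pullback ℝ Θ Y p = (L p).symm (Y (Θ p)) := fun Y p hp =>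
    VectorField.pullback_eq_of_fderiv_eq (hL p hp).fderiv.symm Y
  refine ⟨fun i p hp => ContDiffAt.contDiffWithinAt ?_, fun i j k p hp => ?_, fun i j p hp => ?_⟩
  · have h1 : ContDiffAt ℝ ∞ (fun q => fderiv ℝ Θ.symm (Θ q) (X i (Θ q))) p := by
      have h2 : ContDiffAt ℝ ∞ (fderiv ℝ Θ.symm) (Θ p) := (hΘs p hp).fderiv_right (by simp)
      have h3 : ContDiffAt ℝ ∞ (X i) (Θ p) :=
        (h.contDiffOn i).contDiffAt (hΩ.mem_nhds (hmem p hp))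
      exact (h2.comp p (hΘ p hp)).clm_apply (h3.comp p (hΘ p hp))
    refine h1.congr_of_eventuallyEq ?_
    filter_upwards [Θ.open_source.mem_nhds hp] with q hq
    rw [(hLs q hq).fderiv]; rfl
  · exact ((h.continuousOn i j k).continuousAt (hΩ.mem_nhds (hmem p hp))).comp
      (hΘ p hp).continuousAt |>.continuousWithinAt
  · have hd : ∀ i, DifferentiableAt ℝ (X i) (Θ p) := fun i =>
      ((h.contDiffOn i).contDiffAt (hΩ.mem_nhds (hmem p hp))).differentiableAt (by simp)
    have h1 := VectorField.pullback_lieBracket (n := 2) (by simp)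
      ((hΘ p hp).of_le (ENat.LEInfty.out)) (hd i) (hd j)
    rw [hpb _ p hp, h.lieBracket_eq i j _ (hmem p hp)] at h1
    have h2 : ∀ i, VectorField.pullback ℝ Θ (X i) =ᶠ[𝓝 p] fun p => (L p).symm (X i (Θ p)) := by
      intro i
      filter_upwards [Θ.open_source.mem_nhds hp] with q hq using hpb _ q hq
    rw [((h2 i).lieBracket_vectorField (h2 j)).eq_of_nhds] at h1
    rw [← h1]
    simp [map_sum]

section Slice

variable {Z : ι → ℝ × E' → ℝ × E'} {c : ι → ι → ι → ℝ × E' → ℝ} {Q : Set (ℝ × E')} {i₀ : ι}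

/-- The Lie bracket with a constant field is differentiation in its direction. -/
theorem fderiv_apply_one_zero (h : IsInvolutiveFamily Z c Q) (hQ : IsOpen Q)
    (hZ : ∀ p ∈ Q, Z i₀ p = (1, 0)) (j : ι) {p : ℝ × E'} (hp : p ∈ Q) :
    fderiv ℝ (Z j) p (1, 0) = ∑ k, c i₀ j k p • Z k p := by
  have h1 : Z i₀ =ᶠ[𝓝 p] fun _ => (1, 0) := by
    filter_upwards [hQ.mem_nhds hp] with q hq using hZ q hq
  have h2 := h.lieBracket_eq i₀ j p hp
  simp only [VectorField.lieBracket_eq] at h2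
  rw [h1.fderiv_eq] at h2
  simp only [hZ p hp] at h2
  simpa using h2

/-- If one of the fields of an involutive family is `∂/∂t`, then the components along the slice
`t = 0` of the other fields form an involutive family on the slice. -/
theorem slice (h : IsInvolutiveFamily Z c Q) (hQ : IsOpen Q)
    (hZ : ∀ p ∈ Q, Z i₀ p = (1, 0)) :
    IsInvolutiveFamily (fun i y => (Z i (0, y)).2)
      (fun i j k y => c i j k (0, y) - (Z i (0, y)).1 * c i₀ j k (0, y)
        + (Z j (0, y)).1 * c i₀ i k (0, y)) {y : E' | ((0 : ℝ), y) ∈ Q} := by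
  have hin : ContDiff ℝ ∞ fun y : E' => ((0 : ℝ), y) := contDiff_const.prodMk contDiff_id
  have hZc : ∀ i, ContDiffOn ℝ ∞ (fun y => Z i (0, y)) {y : E' | ((0 : ℝ), y) ∈ Q} := fun i =>
    (h.contDiffOn i).comp hin.contDiffOn fun y hy => hy
  have hcc : ∀ i j k, ContinuousOn (fun y => c i j k (0, y)) {y : E' | ((0 : ℝ), y) ∈ Q} :=
    fun i j k => (h.continuousOn i j k).comp hin.continuous.continuousOn fun y hy => hy
  refine ⟨fun i => contDiff_snd.comp_contDiffOn (hZc i), fun i j k => ?_, fun i j y hy => ?_⟩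
  · exact ((hcc i j k).sub ((continuous_fst.comp_continuousOn (hZc i).continuousOn).mul
      (hcc i₀ j k))).add ((continuous_fst.comp_continuousOn (hZc j).continuousOn).mul
      (hcc i₀ i k))
  · have hy' : ((0 : ℝ), y) ∈ Q := hy
    have hd : ∀ i, fderiv ℝ (fun y => (Z i (0, y)).2) y =
        (ContinuousLinearMap.snd ℝ ℝ E').comp ((fderiv ℝ (Z i) (0, y)).comp
          (ContinuousLinearMap.inr ℝ ℝ E')) := by
      intro i
      have h1 : HasFDerivAt (Z i) (fderiv ℝ (Z i) (0, y)) (0, y) :=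
        (((h.contDiffOn i).contDiffAt (hQ.mem_nhds hy')).differentiableAt (by simp)).hasFDerivAt
      exact (hasFDerivAt_snd.comp y (h1.comp y (hasFDerivAt_prodMk_right (𝕜 := ℝ) (0 : ℝ) y))).fderiv
    -- Each slice field is `Z i` minus a multiple of `Z i₀ = ∂/∂t`. Terms along `∂/∂t` vanish under
    -- the second projection, leaving brackets of the `Z i` alone.
    have hsplit : ∀ i, ((0 : ℝ), (Z i (0, y)).2) =
        Z i (0, y) - (Z i (0, y)).1 • ((1 : ℝ), (0 : E')) := by
      intro i; ext <;> simp
    have hL := h.lieBracket_eq i j _ hy'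
    rw [VectorField.lieBracket_eq] at hL ⊢
    simp only [hd, ContinuousLinearMap.comp_apply, ContinuousLinearMap.inr_apply, hsplit, map_sub,
      map_smul, h.fderiv_apply_one_zero hQ hZ _ hy', ContinuousLinearMap.coe_snd']
    have hL2 := congrArg Prod.snd hL
    simp only [Prod.snd_sub, Prod.snd_sum, Prod.smul_snd] at hL2
    simp only [Prod.snd_sum, Prod.smul_snd, add_smul, sub_smul, Finset.sum_add_distrib,
      Finset.sum_sub_distrib, mul_smul, ← Finset.smul_sum, ← hL2]
    abel

/-- The projection to the slice kills the nonzero vector `Z i₀`. -/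
theorem finrank_span_slice_add_one_le [FiniteDimensional ℝ E']
    (hZ : ∀ p ∈ Q, Z i₀ p = (1, 0)) {y : E'} (hy : ((0 : ℝ), y) ∈ Q) :
    Module.finrank ℝ (Submodule.span ℝ (range fun i => (Z i (0, y)).2)) + 1 ≤
      Module.finrank ℝ (Submodule.span ℝ (range fun i => Z i (0, y))) := by
  set S := Submodule.span ℝ (range fun i => Z i (0, y))
  have h1 := LinearMap.finrank_range_add_finrank_ker ((LinearMap.snd ℝ ℝ E').domRestrict S)
  have h2 : Submodule.map (LinearMap.snd ℝ ℝ E') S =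
      Submodule.span ℝ (range fun i => (Z i (0, y)).2) := by
    rw [Submodule.map_span, ← range_comp]; rfl
  rw [LinearMap.range_domRestrict, h2] at h1
  have h3 : 1 ≤ Module.finrank ℝ ((LinearMap.snd ℝ ℝ E').domRestrict S).ker := by
    rw [Submodule.one_le_finrank_iff, Submodule.ne_bot_iff]
    refine ⟨⟨Z i₀ (0, y), Submodule.subset_span ⟨i₀, rfl⟩⟩, ?_, ?_⟩
    · simp [hZ _ hy]
    · intro h0
      have := congrArg (fun v : S => (v : ℝ × E').1) h0
      simp [hZ _ hy] at this
  omega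

/-- First integrals of the slice fields, extended constantly in the direction `∂/∂t`, are first
integrals of the family. -/
theorem fderiv_snd_eq_zero_of_slice (h : IsInvolutiveFamily Z c Q) (hQ : IsOpen Q)
    (hZ : ∀ p ∈ Q, Z i₀ p = (1, 0)) {y : E'} {t : ℝ}
    (hseg : ∀ s ∈ Icc 0 t, (s, y) ∈ Q) (ht : 0 ≤ t) (ℓ : E' →L[ℝ] ℝ)
    (hℓ : ∀ i, ℓ (Z i (0, y)).2 = 0) (i : ι) : ℓ (Z i (t, y)).2 = 0 := by
  -- Along a `t`-line the functions `ℓ (Z i).2` satisfy a homogeneous linear system, with structure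
  -- functions as coefficients.
  refine eq_zero_of_hasDerivAt_linear_system (T := t) (u := fun i s => ℓ (Z i (s, y)).2)
    (a := fun i k s => c i₀ i k (s, y)) ?_ ?_ hℓ t ⟨ht, le_rfl⟩ i
  · intro i k
    exact (h.continuousOn i₀ i k).comp (by fun_prop) hseg
  · intro i s hs
    have hp := hseg s hs
    have h1 : HasFDerivAt (Z i) (fderiv ℝ (Z i) (s, y)) (s, y) :=
      (((h.contDiffOn i).contDiffAt (hQ.mem_nhds hp)).differentiableAt (by simp)).hasFDerivAt
    have h2 : HasDerivAt (fun s : ℝ => (s, y)) ((1 : ℝ), (0 : E')) s :=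
      (hasDerivAt_id s).prodMk (hasDerivAt_const _ _)
    have h3 := ((ℓ.comp (ContinuousLinearMap.snd ℝ ℝ E')).hasFDerivAt).comp_hasDerivAt s
      (h1.comp_hasDerivAt s h2)
    rw [h.fderiv_apply_one_zero hQ hZ i hp] at h3
    have h4 : (ℓ.comp (ContinuousLinearMap.snd ℝ ℝ E')) (∑ k, c i₀ i k (s, y) • Z k (s, y)) =
        ∑ k, c i₀ i k (s, y) * ℓ (Z k (s, y)).2 := by simp [map_sum]
    rw [h4] at h3
    exact h3

end Slice

end IsInvolutiveFamily

theorem exists_surjective_continuousLinearMap_pi [FiniteDimensional ℝ E] {r : ℕ}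
    (hr : r ≤ Module.finrank ℝ E) : ∃ f : E →L[ℝ] (Fin r → ℝ), Function.Surjective f := by
  let b := Module.finBasis ℝ E
  let f : E →ₗ[ℝ] (Fin r → ℝ) := LinearMap.pi fun j => b.coord (Fin.castLE hr j)
  refine ⟨f.toContinuousLinearMap, fun y => ?_⟩
  refine ⟨b.equivFun.symm fun i => if h : (i : ℕ) < r then y ⟨i, h⟩ else 0, ?_⟩
  ext j
  change b.coord (Fin.castLE hr j) _ = y j
  rw [Module.Basis.coord_apply, ← Module.Basis.equivFun_apply, LinearEquiv.apply_symm_apply]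
  simp

end Frobenius

universe u

/-- **Frobenius theorem**: an involutive family of rank at most `dim - r` has, on some open set,
`r` first integrals with independent differentials. -/
theorem IsInvolutiveFamily.exists_firstIntegrals {ι : Type*} [Fintype ι] (r d : ℕ) :
    ∀ {E : Type u} [NormedAddCommGroup E] [NormedSpace ℝ E] [FiniteDimensional ℝ E],
      Module.finrank ℝ E = d → ∀ {X : ι → E → E} {c : ι → ι → ι → E → ℝ} {Ω : Set E},
      IsInvolutiveFamily X c Ω → IsOpen Ω → Ω.Nonempty →
      (∀ x ∈ Ω, Module.finrank ℝ (Submodule.span ℝ (range fun i => X i x)) + r ≤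
        Module.finrank ℝ E) →
      ∃ V ⊆ Ω, IsOpen V ∧ V.Nonempty ∧ ∃ f : E → Fin r → ℝ, ContDiffOn ℝ ∞ f V ∧
        ∀ x ∈ V, Function.Surjective (fderiv ℝ f x) ∧ ∀ i, fderiv ℝ f x (X i x) = 0 := by
  induction d using Nat.strong_induction_on with
  | _ d ih =>
  intro E _ _ _ hd X c Ω h hΩ hne hrank
  by_cases hzero : ∀ i, ∀ x ∈ Ω, X i x = 0
  · obtain ⟨x, hx⟩ := hne
    obtain ⟨f, hf⟩ := exists_surjective_continuousLinearMap_pi (E := E) (r := r)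
      (le_trans (Nat.le_add_left _ _) (hrank x hx))
    exact ⟨Ω, Subset.rfl, hΩ, ⟨x, hx⟩, f, f.contDiff.contDiffOn, fun x hx => by
      simpa [hzero _ x hx] using hf⟩
  push Not at hzero
  obtain ⟨i₀, x₀, hx₀, hX₀⟩ := hzero
  obtain ⟨E', hfr, Θ, L, h0, htarget, hΘ⟩ := exists_flowBox hΩ (h.contDiffOn i₀) hx₀ hX₀
  have hZ := h.pullback hΩ Θ L htarget (fun p hp => (hΘ p hp).1) (fun p hp => (hΘ p hp).2.1)
    (fun p hp => (hΘ p hp).2.2.1) (fun p hp => (hΘ p hp).2.2.2.1)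
  set Z : ι → ℝ × E' → ℝ × E' := fun i p => (L p).symm (X i (Θ p)) with hZdef
  have hZ₀ : ∀ p ∈ Θ.source, Z i₀ p = (1, 0) := by
    intro p hp
    rw [hZdef]
    simp only [← (hΘ p hp).2.2.2.2, ContinuousLinearEquiv.symm_apply_apply]
  obtain ⟨ε, hε, hball⟩ := Metric.isOpen_iff.1 Θ.open_source _ h0
  rw [← ball_prod_same] at hball
  have hQ : IsOpen (Metric.ball (0 : ℝ) ε ×ˢ Metric.ball (0 : E') ε) :=
    Metric.isOpen_ball.prod Metric.isOpen_ball
  have hZ' := (hZ.mono hball).slice hQ fun p hp => hZ₀ p (hball hp)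
  have hΩ' : {y : E' | ((0 : ℝ), y) ∈ Metric.ball (0 : ℝ) ε ×ˢ Metric.ball (0 : E') ε} =
      Metric.ball 0 ε := by
    ext y; simp [hε]
  rw [hΩ'] at hZ'
  obtain ⟨V', hV'sub, hV'o, hV'ne, g, hg, hg'⟩ := ih (Module.finrank ℝ E') (by omega) rfl hZ'
    Metric.isOpen_ball ⟨0, Metric.mem_ball_self hε⟩ (by
      intro y hy
      have hy' : ((0 : ℝ), y) ∈ Θ.source := hball ⟨Metric.mem_ball_self hε, hy⟩
      -- The dimension drops by one and the rank by at least one, so the bound with the same `r`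
      -- survives on the slice.
      have h1 := IsInvolutiveFamily.finrank_span_slice_add_one_le (Z := Z) hZ₀ hy'
      have h2 : Submodule.span ℝ (range fun i => Z i (0, y)) =
          (Submodule.span ℝ (range fun i => X i (Θ (0, y)))).map
            ((L (0, y)).symm.toLinearEquiv : E →ₗ[ℝ] ℝ × E') := by
        rw [Submodule.map_span, ← range_comp]; rfl
      rw [h2, LinearEquiv.finrank_map_eq] at h1
      have h3 := hrank _ (htarget (Θ.map_source hy'))
      omega)
  -- Only `t > 0` is kept, since the linear system propagates zeros forward from the slice.
  set P : Set (ℝ × E') := Ioo 0 ε ×ˢ V' with hP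
  have hPo : IsOpen P := isOpen_Ioo.prod hV'o
  have hPb : P ⊆ Metric.ball (0 : ℝ) ε ×ˢ Metric.ball (0 : E') ε := by
    rintro ⟨t, y⟩ ⟨ht, hy⟩
    refine ⟨?_, hV'sub hy⟩
    rw [mem_ball_zero_iff, Real.norm_eq_abs, abs_lt]
    exact ⟨by linarith [ht.1], ht.2⟩
  have hPs : P ⊆ Θ.source := hPb.trans hball
  have hsymm : ∀ x ∈ Θ '' P, Θ.symm x ∈ P ∧ Θ (Θ.symm x) = x := by
    rintro _ ⟨p, hp, rfl⟩
    rw [Θ.left_inv (hPs hp)]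
    exact ⟨hp, rfl⟩
  have hVo : IsOpen (Θ '' P) := Θ.isOpen_image_of_subset_source hPo hPs
  have hgat : ∀ x ∈ Θ '' P, ContDiffAt ℝ ∞ g (Θ.symm x).2 := fun x hx =>
    hg.contDiffAt (hV'o.mem_nhds (hsymm x hx).1.2)
  have hΘsat : ∀ x ∈ Θ '' P, ContDiffAt ℝ ∞ Θ.symm x := fun x hx => by
    have := (hΘ _ (hPs (hsymm x hx).1)).2.1
    rwa [(hsymm x hx).2] at this
  refine ⟨Θ '' P, ?_, hVo, ?_, fun x => g (Θ.symm x).2, ?_, ?_⟩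
  · rintro _ ⟨p, hp, rfl⟩
    exact htarget (Θ.map_source (hPs hp))
  · obtain ⟨y, hy⟩ := hV'ne
    exact ⟨_, (ε / 2, y), ⟨⟨half_pos hε, half_lt_self hε⟩, hy⟩, rfl⟩
  · intro x hx
    refine ContDiffAt.contDiffWithinAt ?_
    exact (hgat x hx).comp x (contDiffAt_snd.comp x (hΘsat x hx))
  · intro x hx
    set p := Θ.symm x with hp
    have hpP : p ∈ P := (hsymm x hx).1
    have hΘp : Θ p = x := (hsymm x hx).2
    have hLs := (hΘ p (hPs hpP)).2.2.2.1
    rw [hΘp] at hLs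
    have hgd : HasFDerivAt g (fderiv ℝ g p.2) p.2 :=
      ((hgat x hx).differentiableAt (by simp)).hasFDerivAt
    have hfd : fderiv ℝ (fun x => g (Θ.symm x).2) x = (fderiv ℝ g p.2).comp
        ((ContinuousLinearMap.snd ℝ ℝ E').comp ((L p).symm : E →L[ℝ] ℝ × E')) :=
      (hgd.comp x (hasFDerivAt_snd.comp x hLs)).fderiv
    rw [hfd]
    refine ⟨fun z => ?_, fun i => ?_⟩
    · obtain ⟨v, hv⟩ := (hg' p.2 hpP.2).1 z
      exact ⟨L p (0, v), by simp [hv]⟩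
    · have hseg : ∀ s ∈ Icc 0 p.1,
          (s, p.2) ∈ Metric.ball (0 : ℝ) ε ×ˢ Metric.ball (0 : E') ε := by
        intro s hs
        refine ⟨?_, (hPb hpP).2⟩
        rw [mem_ball_zero_iff, Real.norm_eq_abs, abs_lt]
        exact ⟨by linarith [hs.1], hs.2.trans_lt hpP.1.2⟩
      ext j
      have := (hZ.mono hball).fderiv_snd_eq_zero_of_slice hQ
        (fun p hp => hZ₀ p (hball hp)) hseg hpP.1.1.le
        ((ContinuousLinearMap.proj j).comp (fderiv ℝ g p.2))
        (fun i => by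
          simpa using congrFun ((hg' p.2 hpP.2).2 i) j) i
      simp only [hZdef, Prod.mk.eta, hΘp] at this
      simpa using this

/-! ### Global coordinate maps and derivations at a point. -/

section Coordinates

variable {n : ℕ} {M : Type*} [TopologicalSpace M] [ChartedSpace (EuclideanSpace ℝ (Fin n)) M]

/-- A global smooth map `x : M → ℝⁿ` which restricts to a diffeomorphism, with inverse `ψ`, of the
open set `Ω` onto an open subset of `ℝⁿ`. -/
structure IsCoordinateMap
    (x : C^∞⟮𝓡 n, M; 𝓘(ℝ, EuclideanSpace ℝ (Fin n)), EuclideanSpace ℝ (Fin n)⟯)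
    (ψ : EuclideanSpace ℝ (Fin n) → M) (Ω : Set M) : Prop where
  isOpen : IsOpen Ω
  isOpen_image : IsOpen (x '' Ω)
  left_inv : ∀ m ∈ Ω, ψ (x m) = m
  contMDiffOn : ContMDiffOn 𝓘(ℝ, EuclideanSpace ℝ (Fin n)) (𝓡 n) ∞ ψ (x '' Ω)

/-- A chart times a bump function: the coordinates become global smooth functions, to which brackets
apply. -/
theorem exists_isCoordinateMap [T2Space M] [IsManifold (𝓡 n) ∞ M] (m₀ : M) :
    ∃ x ψ Ω, m₀ ∈ Ω ∧ IsCoordinateMap (M := M) (n := n) x ψ Ω := by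
  obtain ⟨χ⟩ : Nonempty (SmoothBumpFunction (𝓡 n) m₀) := inferInstance
  let x : C^∞⟮𝓡 n, M; 𝓘(ℝ, EuclideanSpace ℝ (Fin n)), EuclideanSpace ℝ (Fin n)⟯ :=
    ⟨fun m => χ m • extChartAt (𝓡 n) m₀ m, χ.contMDiff_smul contMDiffOn_extChartAt⟩
  obtain ⟨U, hU, hUo, hm₀⟩ := eventually_nhds_iff.1 χ.eventuallyEq_one
  have hx : ∀ m ∈ U, x m = extChartAt (𝓡 n) m₀ m := by
    intro m hm
    change χ m • extChartAt (𝓡 n) m₀ m = _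
    rw [hU m hm, Pi.one_apply, one_smul]
  set Ω := (extChartAt (𝓡 n) m₀).source ∩ U with hΩ
  have hΩo : IsOpen Ω := (isOpen_extChartAt_source m₀).inter hUo
  have himg : x '' Ω = (extChartAt (𝓡 n) m₀).target ∩ (extChartAt (𝓡 n) m₀).symm ⁻¹' Ω := by
    ext y
    constructor
    · rintro ⟨m, hm, rfl⟩
      rw [hx m hm.2]
      refine ⟨(extChartAt (𝓡 n) m₀).map_source hm.1, ?_⟩
      rw [mem_preimage, (extChartAt (𝓡 n) m₀).left_inv hm.1]
      exact hm
    · rintro ⟨hy, hyΩ⟩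
      exact ⟨_, hyΩ, by rw [hx _ hyΩ.2, (extChartAt (𝓡 n) m₀).right_inv hy]⟩
  refine ⟨x, (extChartAt (𝓡 n) m₀).symm, Ω, ⟨mem_extChartAt_source m₀, hm₀⟩, hΩo, ?_, ?_, ?_⟩
  · rw [himg]
    exact (continuousOn_extChartAt_symm m₀).isOpen_inter_preimage (isOpen_extChartAt_target m₀) hΩo
  · intro m hm
    rw [hx m hm.2, (extChartAt (𝓡 n) m₀).left_inv hm.1]
  · exact (contMDiffOn_extChartAt_symm m₀).mono (himg ▸ inter_subset_left)

/-- A derivation at a point depends only on germs. -/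
theorem eq_of_eventuallyEq_of_leibniz [T2Space M] [IsManifold (𝓡 n) ∞ M] {m : M}
    (D : C^∞⟮𝓡 n, M; ℝ⟯ →ₗ[ℝ] ℝ) (hD : ∀ f g, D (f * g) = f m * D g + g m * D f)
    {f g : C^∞⟮𝓡 n, M; ℝ⟯} (hfg : (f : M → ℝ) =ᶠ[𝓝 m] g) : D f = D g := by
  obtain ⟨χ, -, hχ⟩ := (SmoothBumpFunction.nhds_basis_tsupport (I := 𝓡 n) m).mem_iff.1 hfg
  let c : C^∞⟮𝓡 n, M; ℝ⟯ := ⟨χ, χ.contMDiff⟩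
  have h0 : c * (f - g) = 0 := by
    ext p
    change χ p * (f p - g p) = 0
    by_cases hp : p ∈ tsupport χ
    · rw [show f p = g p from hχ hp, sub_self, mul_zero]
    · rw [image_eq_zero_of_notMem_tsupport hp, zero_mul]
  have h1 := hD c (f - g)
  have h2 : c m = 1 := χ.eq_one
  have h3 : (f - g) m = 0 := sub_eq_zero.2 hfg.eq_of_nhds
  rw [h0, h2, h3, map_zero, map_sub] at h1
  linarith

section Smooth

variable (x : C^∞⟮𝓡 n, M; 𝓘(ℝ, EuclideanSpace ℝ (Fin n)), EuclideanSpace ℝ (Fin n)⟯)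

/-- A smooth function of the coordinates. -/
noncomputable def ContMDiffMap.postcomp (F : EuclideanSpace ℝ (Fin n) → ℝ) (hF : ContDiff ℝ ∞ F) :
    C^∞⟮𝓡 n, M; ℝ⟯ :=
  ⟨fun m => F (x m), hF.comp_contMDiff x.contMDiff⟩

/-- The `i`-th coordinate function. -/
noncomputable def ContMDiffMap.coord (i : Fin n) : C^∞⟮𝓡 n, M; ℝ⟯ :=
  ContMDiffMap.postcomp x (fun y => y i) (by fun_prop)

end Smooth

theorem ContMDiffMap.sum_apply {ι : Type*} (s : Finset ι) (f : ι → C^∞⟮𝓡 n, M; ℝ⟯) (m : M) :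
    (∑ i ∈ s, f i) m = ∑ i ∈ s, f i m := by
  have h := map_sum (ContMDiffMap.coeFnAddMonoidHom (I := 𝓡 n) (N := M) (I' := 𝓘(ℝ, ℝ))
    (G := ℝ) (n := ∞)) f s
  simpa using congrFun h m

theorem EuclideanSpace.eq_sum_smul_single (v : EuclideanSpace ℝ (Fin n)) :
    v = ∑ i, v i • EuclideanSpace.single i (1 : ℝ) := by
  ext j
  simp [Pi.single_apply]

namespace IsCoordinateMap

variable {x : C^∞⟮𝓡 n, M; 𝓘(ℝ, EuclideanSpace ℝ (Fin n)), EuclideanSpace ℝ (Fin n)⟯}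
  {ψ : EuclideanSpace ℝ (Fin n) → M} {Ω : Set M} (hx : IsCoordinateMap x ψ Ω)
include hx

theorem contDiffOn_comp (f : C^∞⟮𝓡 n, M; ℝ⟯) : ContDiffOn ℝ ∞ (f ∘ ψ) (x '' Ω) :=
  (f.contMDiff.comp_contMDiffOn hx.contMDiffOn).contDiffOn

theorem contDiffAt_comp (f : C^∞⟮𝓡 n, M; ℝ⟯) {m : M} (hm : m ∈ Ω) :
    ContDiffAt ℝ ∞ (f ∘ ψ) (x m) :=
  (hx.contDiffOn_comp f).contDiffAt (hx.isOpen_image.mem_nhds ⟨m, hm, rfl⟩)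

theorem eventuallyEq_comp (f : M → ℝ) {m : M} (hm : m ∈ Ω) : f =ᶠ[𝓝 m] (f ∘ ψ) ∘ x := by
  filter_upwards [hx.isOpen.mem_nhds hm] with p hp
  simp [hx.left_inv p hp]

theorem right_inv {y : EuclideanSpace ℝ (Fin n)} (hy : y ∈ x '' Ω) : ψ y ∈ Ω ∧ x (ψ y) = y := by
  obtain ⟨m, hm, rfl⟩ := hy
  rw [hx.left_inv m hm]
  exact ⟨hm, rfl⟩

/-- A derivation at a point of a coordinate domain is determined by its values at the coordinate
functions. -/
theorem derivation_apply [T2Space M] [IsManifold (𝓡 n) ∞ M] {m : M} (hm : m ∈ Ω)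
    (D : C^∞⟮𝓡 n, M; ℝ⟯ →ₗ[ℝ] ℝ)
    (hD : ∀ f g, D (f * g) = f m * D g + g m * D f) (f : C^∞⟮𝓡 n, M; ℝ⟯) :
    D f = ∑ i, fderiv ℝ (f ∘ ψ) (x m) (EuclideanSpace.single i 1) *
      D (ContMDiffMap.coord x i) := by
  obtain ⟨F, hF, -, hFf⟩ := exists_contDiff_hasCompactSupport_eventuallyEq hx.isOpen_image
    (hx.contDiffOn_comp f) ⟨m, hm, rfl⟩
  obtain ⟨G, hG, hFG, hGm⟩ := exists_contDiff_sub_eq_apply_sub hF (x m)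
  have h1 : (f : M → ℝ) =ᶠ[𝓝 m] ContMDiffMap.postcomp x F hF := by
    refine (hx.eventuallyEq_comp f hm).trans ?_
    exact (x.contMDiff.continuous.continuousAt.eventually hFf).mono fun p hp => hp.symm
  have hone : D 1 = 0 := by
    have := hD 1 1
    simp only [mul_one, ContMDiffMap.coe_one, Pi.one_apply, one_mul] at this
    linarith
  let g : Fin n → C^∞⟮𝓡 n, M; ℝ⟯ := fun i =>
    ContMDiffMap.postcomp x (fun y => G y (EuclideanSpace.single i 1)) (hG.clm_apply contDiff_const)
  -- Hadamard's expansion at `x m`: a derivation kills the constant and sees only the values at `m`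
  -- of the `g i`.
  have h2 : ContMDiffMap.postcomp x F hF = F (x m) • 1 +
      ∑ i, g i * (ContMDiffMap.coord x i - x m i • 1) := by
    ext p
    have h3 : (F (x m) • (1 : C^∞⟮𝓡 n, M; ℝ⟯) +
        ∑ i, g i * (ContMDiffMap.coord x i - x m i • 1)) p =
        F (x m) * 1 + ∑ i, G (x p) (EuclideanSpace.single i 1) * (x p i - x m i * 1) := by
      rw [ContMDiffMap.coe_add, Pi.add_apply, ContMDiffMap.sum_apply]; rfl
    have h4 : G (x p) (x p - x m) =
        ∑ i, G (x p) (EuclideanSpace.single i 1) * (x p i - x m i * 1) := by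
      conv_lhs => rw [EuclideanSpace.eq_sum_smul_single (x p - x m)]
      simp [map_sum, mul_comm]
    rw [h3, ← h4, ← hFG]
    change F (x p) = _
    ring
  have hgi : ∀ i, g i m = fderiv ℝ (f ∘ ψ) (x m) (EuclideanSpace.single i 1) := by
    intro i
    change G (x m) _ = _
    rw [hGm, hFf.fderiv_eq]
  rw [eq_of_eventuallyEq_of_leibniz D hD h1, h2]
  simp only [map_add, map_smul, hone, map_sum, hD, map_sub, smul_zero, zero_add, sub_zero, hgi]
  refine Finset.sum_congr rfl fun i _ => ?_
  have : (ContMDiffMap.coord x i - x m i • (1 : C^∞⟮𝓡 n, M; ℝ⟯)) m = 0 := by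
    change x m i - x m i * 1 = 0
    ring
  rw [this, zero_mul, add_zero]

/-- The differentials of smooth functions at a point of a coordinate domain. -/
theorem exists_mvfderiv_eq [IsManifold (𝓡 n) ∞ M] {m : M} (hm : m ∈ Ω) :
    ∃ A : TangentSpace (𝓡 n) m ≃L[ℝ] EuclideanSpace ℝ (Fin n), ∀ f : C^∞⟮𝓡 n, M; ℝ⟯,
      mvfderiv (𝓡 n) f m = (fderiv ℝ (f ∘ ψ) (x m)).comp
        (A : TangentSpace (𝓡 n) m →L[ℝ] EuclideanSpace ℝ (Fin n)) := by
  have hxm : x m ∈ x '' Ω := ⟨m, hm, rfl⟩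
  have hdx : MDifferentiableAt (𝓡 n) 𝓘(ℝ, EuclideanSpace ℝ (Fin n)) x m :=
    (x.contMDiff m).mdifferentiableAt (by simp)
  have hdψ : MDifferentiableAt 𝓘(ℝ, EuclideanSpace ℝ (Fin n)) (𝓡 n) ψ (x m) :=
    (hx.contMDiffOn.contMDiffAt (hx.isOpen_image.mem_nhds hxm)).mdifferentiableAt (by simp)
  have hdψ' : MDifferentiableAt (𝓡 n) 𝓘(ℝ, EuclideanSpace ℝ (Fin n)) x (ψ (x m)) := by
    rwa [hx.left_inv m hm]
  let d : M → EuclideanSpace ℝ (Fin n) →L[ℝ] EuclideanSpace ℝ (Fin n) := fun p =>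
    mfderiv (𝓡 n) 𝓘(ℝ, EuclideanSpace ℝ (Fin n)) x p
  let d' : EuclideanSpace ℝ (Fin n) →L[ℝ] EuclideanSpace ℝ (Fin n) :=
    mfderiv 𝓘(ℝ, EuclideanSpace ℝ (Fin n)) (𝓡 n) ψ (x m)
  have h1 : d'.comp (d m) = ContinuousLinearMap.id ℝ _ := by
    refine (mfderiv_comp m hdψ hdx).symm.trans ?_
    have h : ψ ∘ x =ᶠ[𝓝 m] id := by
      filter_upwards [hx.isOpen.mem_nhds hm] with p hp using hx.left_inv p hp
    exact (h.mfderiv_eq (I := 𝓡 n) (I' := 𝓡 n)).trans (mfderiv_id (I := 𝓡 n))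
  have h2 : (d m).comp d' = ContinuousLinearMap.id ℝ _ := by
    rw [← congrArg d (hx.left_inv m hm)]
    refine (mfderiv_comp (x m) hdψ' hdψ).symm.trans ?_
    have h : x ∘ ψ =ᶠ[𝓝 (x m)] id := by
      filter_upwards [hx.isOpen_image.mem_nhds hxm] with y hy using (hx.right_inv hy).2
    exact (h.mfderiv_eq (I := 𝓘(ℝ, EuclideanSpace ℝ (Fin n)))
      (I' := 𝓘(ℝ, EuclideanSpace ℝ (Fin n)))).trans mfderiv_id
  let A : EuclideanSpace ℝ (Fin n) ≃L[ℝ] EuclideanSpace ℝ (Fin n) :=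
    ContinuousLinearEquiv.equivOfInverse (d m) d' (fun v => DFunLike.congr_fun h1 v)
      (fun v => DFunLike.congr_fun h2 v)
  refine ⟨A, fun f => ?_⟩
  have hf : MDifferentiableAt 𝓘(ℝ, EuclideanSpace ℝ (Fin n)) 𝓘(ℝ, ℝ) (f ∘ ψ) (x m) :=
    ((hx.contDiffAt_comp f hm).differentiableAt (by simp)).mdifferentiableAt
  have h3 : mvfderiv (𝓡 n) f m = mvfderiv (𝓡 n) ((f ∘ ψ) ∘ x) m := by
    have := (hx.eventuallyEq_comp f hm).mfderiv_eq (I := 𝓡 n) (I' := 𝓘(ℝ, ℝ))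
    ext v
    exact DFunLike.congr_fun this v
  rw [h3, mvfderiv_comp m hf hdx]
  ext v
  change mfderiv 𝓘(ℝ, EuclideanSpace ℝ (Fin n)) 𝓘(ℝ, ℝ) (f ∘ ψ) (x m) _ = _
  rw [mfderiv_eq_fderiv]
  rfl

end IsCoordinateMap

end Coordinates

/-! ### Bilinear forms on covectors built from vector families. -/

section CotangentForms

variable {n : ℕ} {T : Type*} [AddCommGroup T] [Module ℝ T] [TopologicalSpace T]

/-- The components of a covector in a frame. -/
noncomputable def covectorCoordinates (A : T ≃L[ℝ] EuclideanSpace ℝ (Fin n)) :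
    (T →L[ℝ] ℝ) ≃ₗ[ℝ] (Fin n → ℝ) where
  toFun α i := α (A.symm (EuclideanSpace.single i 1))
  map_add' α β := rfl
  map_smul' c α := rfl
  invFun c := (∑ i, c i • (EuclideanSpace.proj i : EuclideanSpace ℝ (Fin n) →L[ℝ] ℝ)).comp
    (A : T →L[ℝ] EuclideanSpace ℝ (Fin n))
  left_inv α := by
    ext v
    have h : v = A.symm (∑ i, A v i • EuclideanSpace.single i (1 : ℝ)) := by
      rw [← EuclideanSpace.eq_sum_smul_single, A.symm_apply_apply]
    conv_rhs => rw [h]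
    simp [map_sum, mul_comm]
  right_inv c := by
    ext i
    simp

/-- The contraction of a covector with a family of vectors indexed by a frame. -/
noncomputable def covectorSharp (A : T ≃L[ℝ] EuclideanSpace ℝ (Fin n))
    (X : Fin n → EuclideanSpace ℝ (Fin n)) : (T →L[ℝ] ℝ) →ₗ[ℝ] EuclideanSpace ℝ (Fin n) :=
  (Fintype.linearCombination ℝ X).comp (covectorCoordinates A).toLinearMap

/-- The bilinear form on covectors given by a family of vectors indexed by a frame. -/
noncomputable def covectorForm (A : T ≃L[ℝ] EuclideanSpace ℝ (Fin n))
    (X : Fin n → EuclideanSpace ℝ (Fin n)) : LinearMap.BilinForm ℝ (T →L[ℝ] ℝ) :=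
  LinearMap.mk₂ ℝ (fun α β => β (A.symm (covectorSharp A X α)))
    (fun α α' β => by simp) (fun c α β => by simp) (fun α β β' => rfl) (fun c α β => rfl)

/-- The kernel is that of the contraction with `X`, whose range is the span of `X`. -/
theorem finrank_ker_covectorForm_add (A : T ≃L[ℝ] EuclideanSpace ℝ (Fin n))
    (X : Fin n → EuclideanSpace ℝ (Fin n)) :
    Module.finrank ℝ (LinearMap.ker (covectorForm A X)) +
      Module.finrank ℝ (Submodule.span ℝ (range X)) = n := by
  have := (covectorCoordinates A).symm.finiteDimensional
  have h1 : LinearMap.ker (covectorForm A X) = LinearMap.ker (covectorSharp A X) := by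
    ext α
    simp only [LinearMap.mem_ker]
    constructor
    · intro h
      ext i
      have := LinearMap.congr_fun h ((EuclideanSpace.proj i : EuclideanSpace ℝ (Fin n) →L[ℝ] ℝ).comp
        (A : T →L[ℝ] EuclideanSpace ℝ (Fin n)))
      simpa [covectorForm] using this
    · intro h
      ext β
      simp [covectorForm, h]
  have h2 := LinearMap.finrank_range_add_finrank_ker (covectorSharp A X)
  have h3 : LinearMap.range (covectorSharp A X) = Submodule.span ℝ (range X) := by
    rw [covectorSharp, LinearMap.range_comp_of_range_eq_top _ (LinearEquiv.range _),
      Fintype.range_linearCombination]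
  rw [h3, (covectorCoordinates A).finrank_eq, Module.finrank_fin_fun] at h2
  rw [h1, add_comm, h2]

end CotangentForms

/-! ### Associated pairings and Hamiltonian fields in coordinates. -/

section PoissonGeometry

variable {n : ℕ} {M : Type*} [TopologicalSpace M] [ChartedSpace (EuclideanSpace ℝ (Fin n)) M]

/-- Evaluation of smooth functions at a point. -/
noncomputable def ContMDiffMap.evalLinearMap (m : M) : C^∞⟮𝓡 n, M; ℝ⟯ →ₗ[ℝ] ℝ where
  toFun f := f m
  map_add' _ _ := rfl
  map_smul' _ _ := rfl

/-- The Hamiltonian vector field of a coordinate function, in coordinates. -/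
noncomputable def hamiltonianField (B : BilinearOperation n M)
    (x : C^∞⟮𝓡 n, M; 𝓘(ℝ, EuclideanSpace ℝ (Fin n)), EuclideanSpace ℝ (Fin n)⟯)
    (ψ : EuclideanSpace ℝ (Fin n) → M) (i : Fin n) (y : EuclideanSpace ℝ (Fin n)) :
    EuclideanSpace ℝ (Fin n) :=
  WithLp.toLp 2 fun j => B (ContMDiffMap.coord x i) (ContMDiffMap.coord x j) (ψ y)

namespace IsCoordinateMap

variable {x : C^∞⟮𝓡 n, M; 𝓘(ℝ, EuclideanSpace ℝ (Fin n)), EuclideanSpace ℝ (Fin n)⟯}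
  {ψ : EuclideanSpace ℝ (Fin n) → M} {Ω : Set M} {B : BilinearOperation n M}

theorem bracket_apply_right [T2Space M] [IsManifold (𝓡 n) ∞ M] (hx : IsCoordinateMap x ψ Ω)
    (hB : IsBracket B) {m : M} (hm : m ∈ Ω) (f g : C^∞⟮𝓡 n, M; ℝ⟯) :
    B f g m = ∑ j, fderiv ℝ (g ∘ ψ) (x m) (EuclideanSpace.single j 1) *
      B f (ContMDiffMap.coord x j) m :=
  hx.derivation_apply hm ((ContMDiffMap.evalLinearMap m).comp (B f)) (fun g h => by
    change B f (g * h) m = g m * B f h m + h m * B f g m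
    rw [hB.2]; rfl) g

theorem bracket_apply_left [T2Space M] [IsManifold (𝓡 n) ∞ M] (hx : IsCoordinateMap x ψ Ω)
    (hB : IsBracket B) {m : M} (hm : m ∈ Ω) (f g : C^∞⟮𝓡 n, M; ℝ⟯) :
    B f g m = ∑ i, fderiv ℝ (f ∘ ψ) (x m) (EuclideanSpace.single i 1) *
      B (ContMDiffMap.coord x i) g m := by
  rw [hB.1 f g]
  change -(B g f m) = _
  rw [hx.bracket_apply_right hB hm g f, ← Finset.sum_neg_distrib]
  refine Finset.sum_congr rfl fun i _ => ?_
  rw [hB.1 _ g]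
  change _ = _ * -(B g _ m)
  ring

theorem bracket_coord_apply [T2Space M] [IsManifold (𝓡 n) ∞ M] (hx : IsCoordinateMap x ψ Ω)
    (hB : IsBracket B) {m : M} (hm : m ∈ Ω) (i : Fin n) (g : C^∞⟮𝓡 n, M; ℝ⟯) :
    B (ContMDiffMap.coord x i) g m =
      fderiv ℝ (g ∘ ψ) (x m) (hamiltonianField B x ψ i (x m)) := by
  rw [hx.bracket_apply_right hB hm,
    EuclideanSpace.eq_sum_smul_single (hamiltonianField B x ψ i (x m)), map_sum]
  refine Finset.sum_congr rfl fun j _ => ?_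
  rw [map_smul, smul_eq_mul, mul_comm, hamiltonianField]
  simp only [hx.left_inv m hm]

theorem exists_mvfderiv_eq_of_mem [IsManifold (𝓡 n) ∞ M] (hx : IsCoordinateMap x ψ Ω)
    {m : M} (hm : m ∈ Ω) (α : Cotangent n m) :
    ∃ f : C^∞⟮𝓡 n, M; ℝ⟯, mvfderiv (𝓡 n) f m = α := by
  obtain ⟨A, hA⟩ := hx.exists_mvfderiv_eq hm
  let ℓ : EuclideanSpace ℝ (Fin n) →L[ℝ] ℝ :=
    α.comp (A.symm : EuclideanSpace ℝ (Fin n) →L[ℝ] TangentSpace (𝓡 n) m)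
  refine ⟨ContMDiffMap.postcomp x ℓ ℓ.contDiff, ?_⟩
  have h1 : (ContMDiffMap.postcomp x ℓ ℓ.contDiff ∘ ψ) =ᶠ[𝓝 (x m)] ℓ := by
    filter_upwards [hx.isOpen_image.mem_nhds ⟨m, hm, rfl⟩] with y hy
    change ℓ (x (ψ y)) = ℓ y
    rw [(hx.right_inv hy).2]
  rw [hA, h1.fderiv_eq, ContinuousLinearMap.fderiv]
  ext v
  simp [ℓ]

theorem exists_isAssociatedPairing [T2Space M] [IsManifold (𝓡 n) ∞ M]
    (hx : IsCoordinateMap x ψ Ω) (hB : IsBracket B) {m : M} (hm : m ∈ Ω) :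
    ∃ b, IsAssociatedPairing B m b ∧ Module.finrank ℝ (LinearMap.ker b) +
      Module.finrank ℝ (Submodule.span ℝ (range fun i => hamiltonianField B x ψ i (x m))) = n := by
  obtain ⟨A, hA⟩ := hx.exists_mvfderiv_eq hm
  refine ⟨covectorForm A fun i => hamiltonianField B x ψ i (x m), fun f g => ?_,
    finrank_ker_covectorForm_add A _⟩
  rw [hx.bracket_apply_left hB hm]
  simp only [hx.bracket_coord_apply hB hm, hA f, hA g, covectorForm, LinearMap.mk₂_apply,
    covectorSharp, covectorCoordinates, LinearMap.comp_apply, Fintype.linearCombination_apply,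
    ContinuousLinearMap.comp_apply]
  simp

theorem isAssociatedPairing_unique [IsManifold (𝓡 n) ∞ M] (hx : IsCoordinateMap x ψ Ω)
    {m : M} (hm : m ∈ Ω) {b b' : LinearMap.BilinForm ℝ (Cotangent n m)}
    (hb : IsAssociatedPairing B m b) (hb' : IsAssociatedPairing B m b') : b = b' := by
  refine LinearMap.ext₂ fun α β => ?_
  obtain ⟨f, rfl⟩ := hx.exists_mvfderiv_eq_of_mem hm α
  obtain ⟨g, rfl⟩ := hx.exists_mvfderiv_eq_of_mem hm β
  rw [hb, hb']

theorem isAlt_of_isAssociatedPairing [IsManifold (𝓡 n) ∞ M] (hx : IsCoordinateMap x ψ Ω)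
    {m : M} (hm : m ∈ Ω) {b : LinearMap.BilinForm ℝ (Cotangent n m)} (hB : IsBracket B)
    (hb : IsAssociatedPairing B m b) : b.IsAlt := by
  intro α
  obtain ⟨f, rfl⟩ := hx.exists_mvfderiv_eq_of_mem hm α
  have h : B f f m = -(B f f m) := congrArg (fun g : C^∞⟮𝓡 n, M; ℝ⟯ => g m) (hB.1 f f)
  rw [hb]
  linarith

theorem finrank_ker_add_finrank_span [T2Space M] [IsManifold (𝓡 n) ∞ M]
    (hx : IsCoordinateMap x ψ Ω) (hB : IsBracket B) {m : M} (hm : m ∈ Ω)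
    {b : LinearMap.BilinForm ℝ (Cotangent n m)} (hb : IsAssociatedPairing B m b) :
    Module.finrank ℝ (LinearMap.ker b) +
      Module.finrank ℝ (Submodule.span ℝ (range fun i => hamiltonianField B x ψ i (x m))) = n := by
  obtain ⟨b', hb', h⟩ := hx.exists_isAssociatedPairing hB hm
  rwa [hx.isAssociatedPairing_unique hm hb hb']

theorem contDiffOn_hamiltonianField (hx : IsCoordinateMap x ψ Ω) (i : Fin n) :
    ContDiffOn ℝ ∞ (hamiltonianField B x ψ i) (x '' Ω) :=
  contDiffOn_euclidean.2 fun j =>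
    hx.contDiffOn_comp (B (ContMDiffMap.coord x i) (ContMDiffMap.coord x j))

theorem fderiv_hamiltonianField_apply (hx : IsCoordinateMap x ψ Ω) (i k : Fin n) {m : M}
    (hm : m ∈ Ω) (v : EuclideanSpace ℝ (Fin n)) :
    fderiv ℝ (hamiltonianField B x ψ i) (x m) v k =
      fderiv ℝ (B (ContMDiffMap.coord x i) (ContMDiffMap.coord x k) ∘ ψ) (x m) v := by
  have h1 : HasFDerivAt (hamiltonianField B x ψ i) _ (x m) :=
    (((hx.contDiffOn_hamiltonianField i).contDiffAt
      (hx.isOpen_image.mem_nhds ⟨m, hm, rfl⟩)).differentiableAt (by simp)).hasFDerivAt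
  have h2 := ((EuclideanSpace.proj k : EuclideanSpace ℝ (Fin n) →L[ℝ] ℝ).hasFDerivAt).comp
    (x m) h1
  exact (DFunLike.congr_fun h2.fderiv v).symm

/-- The Hamiltonian vector fields of the coordinate functions form an involutive family. -/
theorem isInvolutiveFamily_hamiltonianField [T2Space M] [IsManifold (𝓡 n) ∞ M]
    (hx : IsCoordinateMap x ψ Ω) (hB : IsPoisson B) :
    IsInvolutiveFamily (hamiltonianField B x ψ)
      (fun i j k y => fderiv ℝ (B (ContMDiffMap.coord x i) (ContMDiffMap.coord x j) ∘ ψ) y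
        (EuclideanSpace.single k 1)) (x '' Ω) := by
  refine ⟨hx.contDiffOn_hamiltonianField, fun i j k => ?_, ?_⟩
  · exact ((hx.contDiffOn_comp _).continuousOn_fderiv_of_isOpen hx.isOpen_image
      (by simp)).clm_apply continuousOn_const
  · rintro i j _ ⟨m, hm, rfl⟩
    ext k
    -- The Jacobi identity for three coordinates is the `k`-th component of the bracket formula;
    -- expanding the outer bracket with `{xᵢ, xⱼ}` by the chain rule produces the structure
    -- functions.
    have hJ : ((B (ContMDiffMap.coord x i) (B (ContMDiffMap.coord x j) (ContMDiffMap.coord x k)) +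
        B (ContMDiffMap.coord x j) (B (ContMDiffMap.coord x k) (ContMDiffMap.coord x i)) +
        B (ContMDiffMap.coord x k) (B (ContMDiffMap.coord x i) (ContMDiffMap.coord x j)) :
        C^∞⟮𝓡 n, M; ℝ⟯)) m = 0 := by
      rw [hB.2]; rfl
    rw [hB.1.1 (ContMDiffMap.coord x k) (ContMDiffMap.coord x i), map_neg,
      hB.1.1 (ContMDiffMap.coord x k)] at hJ
    change B _ (B _ _) m + -(B _ (B _ _) m) + -(B (B _ _) _ m) = 0 at hJ
    rw [hx.bracket_apply_left hB.1 hm (B (ContMDiffMap.coord x i) (ContMDiffMap.coord x j)),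
      hx.bracket_coord_apply hB.1 hm, hx.bracket_coord_apply hB.1 hm] at hJ
    simp only [VectorField.lieBracket_eq, PiLp.sub_apply, hx.fderiv_hamiltonianField_apply _ _ hm]
    rw [← sub_eq_zero, ← hJ]
    simp [hamiltonianField, hx.left_inv m hm]
    ring

end IsCoordinateMap

end PoissonGeometry

/-! ### Lower semicontinuity of rank. -/

section Semicontinuity

/-- The dimension of the span of a continuous family of vectors is lower semicontinuous. -/
theorem eventually_finrank_span_range_le {Y κ F : Type*} [TopologicalSpace Y]
    [NormedAddCommGroup F] [NormedSpace ℝ F] [FiniteDimensional ℝ F] (v : κ → Y → F) {y₀ : Y}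
    (hv : ∀ k, ContinuousAt (v k) y₀) :
    ∀ᶠ y in 𝓝 y₀, Module.finrank ℝ (Submodule.span ℝ (range fun k => v k y₀)) ≤
      Module.finrank ℝ (Submodule.span ℝ (range fun k => v k y)) := by
  obtain ⟨f, hf, -, hli⟩ :=
    Submodule.exists_fun_fin_finrank_span_eq ℝ (range fun k => v k y₀)
  choose k hk using hf
  have hc : ContinuousAt (fun y i => v (k i) y) y₀ := continuousAt_pi.2 fun i => hv (k i)
  have hli' : LinearIndependent ℝ fun i => v (k i) y₀ := by
    rw [show (fun i => v (k i) y₀) = f from funext hk]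
    exact hli
  filter_upwards [hc.eventually (isOpen_setOfPred_linearIndependent.mem_nhds hli')] with y hy
  have h1 := finrank_span_eq_card (show LinearIndependent ℝ fun i => v (k i) y from hy)
  rw [Fintype.card_fin] at h1
  rw [← h1]
  refine Submodule.finrank_mono (Submodule.span_mono ?_)
  rintro _ ⟨i, rfl⟩
  exact ⟨k i, rfl⟩

end Semicontinuity

/-! ### One-block decompositions. -/

section Decomposition

variable {V : Type*} [AddCommGroup V] [Module ℝ V]

theorem IsIndecomposablePair.restrict_top {b₁ b₂ : LinearMap.BilinForm ℝ V}
    (h : IsIndecomposablePair b₁ b₂) :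
    IsIndecomposablePair (b₁.restrict ⊤) (b₂.restrict ⊤) := by
  have := h.1
  refine ⟨(Submodule.topEquiv (R := ℝ) (M := V)).toEquiv.nontrivial, fun P Q hPQ hb => ?_⟩
  let e := (Submodule.topEquiv (R := ℝ) (M := V))
  have hc : IsCompl (P.map e.toLinearMap) (Q.map e.toLinearMap) :=
    (Submodule.orderIsoMapComap e).isCompl hPQ
  rcases h.2 _ _ hc (by
    rintro _ ⟨x, hx, rfl⟩ _ ⟨y, hy, rfl⟩
    exact hb x hx y hy) with h0 | h0
  · exact Or.inl (Submodule.map_eq_bot_iff.1 h0)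
  · exact Or.inr (Submodule.map_eq_bot_iff.1 h0)

theorem IsIndecomposablePair.decomposesIntoBlocks {b₁ b₂ : LinearMap.BilinForm ℝ V}
    (h : IsIndecomposablePair b₁ b₂) :
    DecomposesIntoBlocks b₁ b₂ [Module.finrank ℝ V] := by
  have hsub : Subsingleton (Fin [Module.finrank ℝ V].length) := Fin.subsingleton_one
  refine ⟨fun _ => ⊤, ?_, fun i j hij => (hij (Subsingleton.elim i j)).elim, fun i => ⟨?_, ?_⟩⟩
  · refine DirectSum.isInternal_submodule_of_iSupIndep_of_iSup_eq_top (iSupIndep_subsingleton _) ?_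
    have : Nonempty (Fin [Module.finrank ℝ V].length) := ⟨⟨0, by simp⟩⟩
    exact iSup_const
  · rw [finrank_top, Subsingleton.elim i ⟨0, by simp⟩]; rfl
  · exact h.restrict_top

end Decomposition

/-! ### Real and complex Casimir functions, and their abundance in corank two. -/

section Casimirs

variable {n : ℕ} {M : Type*} [TopologicalSpace M] [ChartedSpace (EuclideanSpace ℝ (Fin n)) M]

section Extended

variable {𝕜 : Type*} [RCLike 𝕜]

/-- A smooth real function as a smooth `𝕜`-valued function. -/
noncomputable def ContMDiffMap.ofRealMap (g : C^∞⟮𝓡 n, M; ℝ⟯) : C^∞⟮𝓡 n, M; 𝓘(ℝ, 𝕜), 𝕜⟯ :=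
  ⟨fun m => (g m : 𝕜), (RCLike.ofRealCLM (K := 𝕜)).contDiff.comp_contMDiff g.contMDiff⟩

/-- Testing against a real function separates the two parts; over `ℝ` the imaginary part is zero
anyway. -/
theorem IsCasimir.rePart_imPart {B : BilinearOperation n M} {F : C^∞⟮𝓡 n, M; 𝓘(ℝ, 𝕜), 𝕜⟯}
    (hF : IsCasimir B F) (g : C^∞⟮𝓡 n, M; ℝ⟯) (m : M) :
    B (rePart F) g m = 0 ∧ B (imPart F) g m = 0 := by
  have h := hF (ContMDiffMap.ofRealMap g) m
  have hre : rePart (ContMDiffMap.ofRealMap (𝕜 := 𝕜) g) = g := by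
    ext p; exact RCLike.ofReal_re _
  have him : imPart (ContMDiffMap.ofRealMap (𝕜 := 𝕜) g) = 0 := by
    ext p; exact RCLike.ofReal_im _
  have h0 : (0 : C^∞⟮𝓡 n, M; ℝ⟯) m = 0 := rfl
  simp only [extendedBracket, hre, him, map_zero, h0, sub_zero, zero_add] at h
  have h1 := congrArg RCLike.re h
  have h2 := congrArg RCLike.im h
  simp only [map_add, RCLike.ofReal_re, RCLike.ofReal_im, RCLike.re_mul_ofReal,
    RCLike.im_mul_ofReal, RCLike.I_re, zero_mul, add_zero, zero_add, map_zero] at h1 h2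
  refine ⟨h1, ?_⟩
  rcases RCLike.I_eq_zero_or_im_I_eq_one (K := 𝕜) with hI | hI
  · have : imPart F = 0 := by
      ext p; exact RCLike.im_eq_zero hI _
    rw [this]; simp [h0]
  · rwa [hI, one_mul] at h2

theorem mvfderiv_rePart (F : C^∞⟮𝓡 n, M; 𝓘(ℝ, 𝕜), 𝕜⟯) (m : M) :
    mvfderiv (𝓡 n) (rePart F) m = (RCLike.reCLM (K := 𝕜)).comp (mvfderiv (𝓡 n) F m) := by
  have h1 : MDifferentiableAt 𝓘(ℝ, 𝕜) 𝓘(ℝ, ℝ) (RCLike.reCLM (K := 𝕜)) (F m) :=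
    (RCLike.reCLM (K := 𝕜)).differentiableAt.mdifferentiableAt
  have h2 : MDifferentiableAt (𝓡 n) 𝓘(ℝ, 𝕜) F m := (F.contMDiff m).mdifferentiableAt (by simp)
  refine (mvfderiv_comp m h1 h2).trans ?_
  ext v
  change mfderiv 𝓘(ℝ, 𝕜) 𝓘(ℝ, ℝ) (RCLike.reCLM (K := 𝕜)) (F m) _ = _
  rw [mfderiv_eq_fderiv, ContinuousLinearMap.fderiv]
  rfl

theorem mvfderiv_imPart (F : C^∞⟮𝓡 n, M; 𝓘(ℝ, 𝕜), 𝕜⟯) (m : M) :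
    mvfderiv (𝓡 n) (imPart F) m = (RCLike.imCLM (K := 𝕜)).comp (mvfderiv (𝓡 n) F m) := by
  have h1 : MDifferentiableAt 𝓘(ℝ, 𝕜) 𝓘(ℝ, ℝ) (RCLike.imCLM (K := 𝕜)) (F m) :=
    (RCLike.imCLM (K := 𝕜)).differentiableAt.mdifferentiableAt
  have h2 : MDifferentiableAt (𝓡 n) 𝓘(ℝ, 𝕜) F m := (F.contMDiff m).mdifferentiableAt (by simp)
  refine (mvfderiv_comp m h1 h2).trans ?_
  ext v
  change mfderiv 𝓘(ℝ, 𝕜) 𝓘(ℝ, ℝ) (RCLike.imCLM (K := 𝕜)) (F m) _ = _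
  rw [mfderiv_eq_fderiv, ContinuousLinearMap.fderiv]
  rfl

/-- The real and imaginary parts of the functions `F s`, `s ∈ S`. -/
noncomputable def reImParts (F : ℝ → C^∞⟮𝓡 n, M; 𝓘(ℝ, 𝕜), 𝕜⟯) (S : Set ℝ) :
    S ⊕ S → C^∞⟮𝓡 n, M; ℝ⟯ :=
  Sum.elim (fun s => rePart (F s)) fun s => imPart (F s)

/-- A real basis of the span of the real and imaginary parts generates, over `𝕜`, a space containing
every differential of `F s`. This reduces the complex case to real covectors. -/
theorem finrank_differentialSpan_le (F : ℝ → C^∞⟮𝓡 n, M; 𝓘(ℝ, 𝕜), 𝕜⟯) (S : Set ℝ) (m : M) :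
    Module.finrank 𝕜 (differentialSpan F S m) ≤
      Module.finrank ℝ (Submodule.span ℝ
        (range fun k => mvfderiv (𝓡 n) (reImParts F S k) m)) := by
  have : FiniteDimensional ℝ (Cotangent n m) :=
    inferInstanceAs (FiniteDimensional ℝ (EuclideanSpace ℝ (Fin n) →L[ℝ] ℝ))
  obtain ⟨f, hf, hspan, -⟩ := Submodule.exists_fun_fin_finrank_span_eq ℝ
    (range fun k => mvfderiv (𝓡 n) (reImParts F S k) m)
  let J : Cotangent n m →ₗ[ℝ] (TangentSpace (𝓡 n) m →L[ℝ] 𝕜) :=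
    { toFun := fun α => (RCLike.ofRealCLM (K := 𝕜)).comp α
      map_add' := fun α β => by ext v; simp
      map_smul' := fun c α => by ext v; simp [RCLike.real_smul_eq_coe_mul] }
  have hle : differentialSpan F S m ≤ Submodule.span 𝕜 (range fun i => J (f i)) := by
    have hJ : ∀ α ∈ Submodule.span ℝ (range f), J α ∈ Submodule.span 𝕜 (range fun i => J (f i)) := by
      intro α hα
      have h1 : J α ∈ (Submodule.span ℝ (range f)).map J := ⟨α, hα, rfl⟩
      rw [Submodule.map_span, ← range_comp] at h1
      exact Submodule.span_subset_span ℝ 𝕜 _ h1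
    refine Submodule.span_le.2 ?_
    rintro _ ⟨s, hs, rfl⟩
    rw [hspan] at hJ
    have hre := hJ (mvfderiv (𝓡 n) (rePart (F s)) m)
      (Submodule.subset_span ⟨Sum.inl ⟨s, hs⟩, rfl⟩)
    have him := hJ (mvfderiv (𝓡 n) (imPart (F s)) m)
      (Submodule.subset_span ⟨Sum.inr ⟨s, hs⟩, rfl⟩)
    have heq : mvfderiv (𝓡 n) (F s) m = J (mvfderiv (𝓡 n) (rePart (F s)) m) +
        (RCLike.I : 𝕜) • J (mvfderiv (𝓡 n) (imPart (F s)) m) := by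
      rw [mvfderiv_rePart, mvfderiv_imPart]
      ext v
      simp [J, mul_comm (RCLike.I : 𝕜), RCLike.re_add_im]
    change mvfderiv (𝓡 n) (F s) m ∈ _
    rw [heq]
    exact add_mem hre (Submodule.smul_mem _ _ him)
  have hfin : (range fun i => J (f i)).Finite := finite_range _
  have := FiniteDimensional.span_of_finite 𝕜 hfin
  refine (Submodule.finrank_mono hle).trans ?_
  exact (finrank_range_le_card (R := 𝕜) fun i => J (f i)).trans_eq (Fintype.card_fin _)

end Extended

namespace IsCoordinateMap

variable {x : C^∞⟮𝓡 n, M; 𝓘(ℝ, EuclideanSpace ℝ (Fin n)), EuclideanSpace ℝ (Fin n)⟯}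
  {ψ : EuclideanSpace ℝ (Fin n) → M} {Ω : Set M} {B : BilinearOperation n M}

theorem mono (hx : IsCoordinateMap x ψ Ω) {O : Set M} (hO : IsOpen O) (hOΩ : O ⊆ Ω) :
    IsCoordinateMap x ψ O := by
  have himg : x '' O = x '' Ω ∩ ψ ⁻¹' O := by
    ext y
    constructor
    · rintro ⟨m, hm, rfl⟩
      refine ⟨⟨m, hOΩ hm, rfl⟩, ?_⟩
      rwa [mem_preimage, hx.left_inv m (hOΩ hm)]
    · rintro ⟨hy, hyO⟩
      exact ⟨ψ y, hyO, (hx.right_inv hy).2⟩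
  refine ⟨hO, ?_, fun m hm => hx.left_inv m (hOΩ hm), hx.contMDiffOn.mono (image_mono hOΩ)⟩
  rw [himg]
  exact hx.contMDiffOn.continuousOn.isOpen_inter_preimage hx.isOpen_image hO

/-- Where the corank of a Poisson bracket exceeds one there are, locally, two independent Casimir
functions. -/
theorem exists_independent_casimirs [T2Space M] [IsManifold (𝓡 n) ∞ M]
    (hx : IsCoordinateMap x ψ Ω) (hB : IsPoisson B) (hne : Ω.Nonempty)
    (hrank : ∀ m ∈ Ω, Module.finrank ℝ
      (Submodule.span ℝ (range fun i => hamiltonianField B x ψ i (x m))) + 2 ≤ n) :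
    ∃ V ⊆ Ω, IsOpen V ∧ ∃ f : Fin 2 → M → ℝ, (∀ i, IsCasimirOn B V (f i)) ∧
      ¬ AreDependentOn V f := by
  obtain ⟨V', hV'sub, hV'o, ⟨_, hy₀⟩, g, hg, hg'⟩ :=
    (hx.isInvolutiveFamily_hamiltonianField hB).exists_firstIntegrals 2 _ rfl hx.isOpen_image
      (hne.image x) (by
        rintro _ ⟨m, hm, rfl⟩
        simpa using hrank m hm)
  obtain ⟨m₁, hm₁, rfl⟩ := hV'sub hy₀
  have hgat : ∀ y ∈ V', ContDiffAt ℝ ∞ g y := fun y hy => hg.contDiffAt (hV'o.mem_nhds hy)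
  refine ⟨Ω ∩ x ⁻¹' V', inter_subset_left,
    hx.isOpen.inter (hV'o.preimage x.contMDiff.continuous), fun i m => g (x m) i,
    fun i => ⟨?_, ?_⟩, fun hdep => ?_⟩
  · have h1 : ContDiffOn ℝ ∞ (fun y => g y i) V' := contDiffOn_pi.1 hg i
    exact h1.contMDiffOn.comp x.contMDiff.contMDiffOn fun m hm => hm.2
  · intro m hm f' h hf'
    have h1 : (f' ∘ ψ) =ᶠ[𝓝 (x m)] fun y => g y i := by
      have hψ : Tendsto ψ (𝓝 (x m)) (𝓝 m) := by
        have := (hx.contMDiffOn.continuousOn).continuousAt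
          (hx.isOpen_image.mem_nhds ⟨m, hm.1, rfl⟩)
        rwa [ContinuousAt, hx.left_inv m hm.1] at this
      filter_upwards [hψ.eventually hf', hx.isOpen_image.mem_nhds ⟨m, hm.1, rfl⟩] with y hy hyΩ
      rw [Function.comp_apply, hy, (hx.right_inv hyΩ).2]
    have h2 : ∀ j, fderiv ℝ (f' ∘ ψ) (x m) (hamiltonianField B x ψ j (x m)) = 0 := by
      intro j
      have h3 := ((ContinuousLinearMap.proj (R := ℝ) (φ := fun _ : Fin 2 => ℝ) i).hasFDerivAt).comp
        (x m) ((hgat _ hm.2).differentiableAt (by simp)).hasFDerivAt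
      have h4 : fderiv ℝ (fun y => g y i) (x m) = _ := h3.fderiv
      rw [h1.fderiv_eq, h4, ContinuousLinearMap.comp_apply, (hg' _ hm.2).2 j]
      rfl
    rw [hx.bracket_apply_right hB.1 hm.1]
    refine Finset.sum_eq_zero fun j _ => ?_
    rw [hB.1.1]
    change _ * -(B _ _ m) = 0
    rw [hx.bracket_coord_apply hB.1 hm.1, h2, neg_zero, mul_zero]
  · obtain ⟨φ, -, hφ, hφ0⟩ := hdep m₁ ⟨hm₁, hy₀⟩
    have hψ : Tendsto ψ (𝓝 (x m₁)) (𝓝 m₁) := by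
      have := (hx.contMDiffOn.continuousOn).continuousAt
        (hx.isOpen_image.mem_nhds ⟨m₁, hm₁, rfl⟩)
      rwa [ContinuousAt, hx.left_inv m₁ hm₁] at this
    have h1 : ∀ᶠ y in 𝓝 (x m₁), φ (g y) = 0 := by
      filter_upwards [hψ.eventually hφ0, hx.isOpen_image.mem_nhds ⟨m₁, hm₁, rfl⟩] with y hy hyΩ
      rwa [(hx.right_inv hyΩ).2] at hy
    -- A submersion maps neighbourhoods onto neighbourhoods, so `φ` would vanish on an open subset
    -- of the plane.
    have h2 : HasStrictFDerivAt g (fderiv ℝ g (x m₁)) (x m₁) :=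
      (hgat _ hy₀).hasStrictFDerivAt (by simp)
    have h3 := h2.map_nhds_eq_of_surj (LinearMap.range_eq_top.2 (hg' _ hy₀).1)
    have h4 : ∀ᶠ z in 𝓝 (g (x m₁)), φ z = 0 := by
      rw [← h3]; exact h1
    obtain ⟨O, hO, hOo, hzO⟩ := eventually_nhds_iff.1 h4
    obtain ⟨z, hz, hz0⟩ := hφ O hOo ⟨_, hzO⟩
    exact hz0 (hO z hz)

end IsCoordinateMap

end Casimirs

/-! ### From rank conditions to Kronecker pairs. -/

section MainTheorem

variable {n : ℕ} {M : Type*} [TopologicalSpace M] [ChartedSpace (EuclideanSpace ℝ (Fin n)) M]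

theorem finrank_cotangent (m : M) : Module.finrank ℝ (Cotangent n m) = n := by
  change Module.finrank ℝ (EuclideanSpace ℝ (Fin n) →L[ℝ] ℝ) = n
  rw [(covectorCoordinates (ContinuousLinearEquiv.refl ℝ _)).finrank_eq, Module.finrank_fin_fun]

theorem finiteDimensional_cotangent (m : M) : FiniteDimensional ℝ (Cotangent n m) :=
  inferInstanceAs (FiniteDimensional ℝ (EuclideanSpace ℝ (Fin n) →L[ℝ] ℝ))

theorem IsAssociatedPairing.add_smul {B₁ B₂ : BilinearOperation n M} {m : M}
    {b₁ b₂ : LinearMap.BilinForm ℝ (Cotangent n m)} (h₁ : IsAssociatedPairing B₁ m b₁)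
    (h₂ : IsAssociatedPairing B₂ m b₂) (a₁ a₂ : ℝ) :
    IsAssociatedPairing (a₁ • B₁ + a₂ • B₂) m (a₁ • b₁ + a₂ • b₂) := by
  intro f g
  change a₁ * b₁ _ _ + a₂ * b₂ _ _ = a₁ * B₁ f g m + a₂ * B₂ f g m
  rw [h₁, h₂]

namespace IsCoordinateMap

variable {x : C^∞⟮𝓡 n, M; 𝓘(ℝ, EuclideanSpace ℝ (Fin n)), EuclideanSpace ℝ (Fin n)⟯}
  {ψ : EuclideanSpace ℝ (Fin n) → M} {Ω : Set M}

theorem finrank_span_mvfderiv_eq [IsManifold (𝓡 n) ∞ M] (hx : IsCoordinateMap x ψ Ω) {κ : Type*}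
    (f : κ → C^∞⟮𝓡 n, M; ℝ⟯) {m : M} (hm : m ∈ Ω) :
    Module.finrank ℝ (Submodule.span ℝ (range fun k => mvfderiv (𝓡 n) (f k) m)) =
      Module.finrank ℝ (Submodule.span ℝ (range fun k => fderiv ℝ (f k ∘ ψ) (x m))) := by
  obtain ⟨A, hA⟩ := hx.exists_mvfderiv_eq hm
  let e : (EuclideanSpace ℝ (Fin n) →L[ℝ] ℝ) ≃ₗ[ℝ] Cotangent n m :=
    { toFun := fun ℓ => ℓ.comp (A : TangentSpace (𝓡 n) m →L[ℝ] EuclideanSpace ℝ (Fin n))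
      invFun := fun α => α.comp (A.symm : EuclideanSpace ℝ (Fin n) →L[ℝ] TangentSpace (𝓡 n) m)
      map_add' := fun _ _ => rfl
      map_smul' := fun _ _ => rfl
      left_inv := fun ℓ => by ext v; simp
      right_inv := fun α => by ext v; simp }
  have h : (range fun k => mvfderiv (𝓡 n) (f k) m) =
      e '' range fun k => fderiv ℝ (f k ∘ ψ) (x m) := by
    rw [← range_comp]
    exact congrArg range (funext fun k => hA (f k))
  rw [h]
  exact (congrArg (fun p : Submodule ℝ (Cotangent n m) => Module.finrank ℝ p)
    (Submodule.map_span e.toLinearMap _)).symm.trans (e.finrank_map_eq _)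

theorem eventually_finrank_span_mvfderiv_le [IsManifold (𝓡 n) ∞ M] (hx : IsCoordinateMap x ψ Ω)
    {κ : Type*} (f : κ → C^∞⟮𝓡 n, M; ℝ⟯) {m₀ : M} (hm₀ : m₀ ∈ Ω) :
    ∀ᶠ m in 𝓝 m₀,
      Module.finrank ℝ (Submodule.span ℝ (range fun k => mvfderiv (𝓡 n) (f k) m₀)) ≤
        Module.finrank ℝ (Submodule.span ℝ (range fun k => mvfderiv (𝓡 n) (f k) m)) := by
  have h := eventually_finrank_span_range_le (y₀ := m₀)
    (fun k m => fderiv ℝ (f k ∘ ψ) (x m)) fun k =>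
      (((hx.contDiffAt_comp (f k) hm₀).fderiv_right (m := 0) (by simp)).continuousAt).comp
        x.contMDiff.continuous.continuousAt
  filter_upwards [h, hx.isOpen.mem_nhds hm₀] with m hm hmΩ
  rwa [hx.finrank_span_mvfderiv_eq f hm₀, hx.finrank_span_mvfderiv_eq f hmΩ]

theorem eventually_finrank_span_hamiltonianField_le (hx : IsCoordinateMap x ψ Ω)
    (B : BilinearOperation n M) {m₀ : M} (hm₀ : m₀ ∈ Ω) :
    ∀ᶠ m in 𝓝 m₀,
      Module.finrank ℝ (Submodule.span ℝ (range fun i => hamiltonianField B x ψ i (x m₀))) ≤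
        Module.finrank ℝ (Submodule.span ℝ (range fun i => hamiltonianField B x ψ i (x m))) :=
  eventually_finrank_span_range_le (fun i m => hamiltonianField B x ψ i (x m)) fun i =>
    (((hx.contDiffOn_hamiltonianField i).continuousOn.continuousAt
      (hx.isOpen_image.mem_nhds ⟨m₀, hm₀, rfl⟩)).comp x.contMDiff.continuous.continuousAt)

/-- At a point where the Casimir differentials span at least half of the cotangent space and some
bracket of the pencil has corank at most one, the pair of pairings is a Kronecker pair. -/
theorem isKroneckerPair [T2Space M] [IsManifold (𝓡 n) ∞ M] (hx : IsCoordinateMap x ψ Ω)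
    (hn : n ≠ 0) {B₁ B₂ : BilinearOperation n M} (hB : IsBihamiltonian B₁ B₂)
    {𝕜 : Type*} [RCLike 𝕜] {S : Set ℝ} (hS : IsOpen S)
    {F : ℝ → C^∞⟮𝓡 n, M; 𝓘(ℝ, 𝕜), 𝕜⟯} (hF : ∀ s ∈ S, IsCasimir (s • B₁ + B₂) (F s))
    {m : M} (hm : m ∈ Ω) (hcont : ContinuousOn (fun s => mvfderiv (𝓡 n) (F s) m) S)
    (hdim : n ≤ 2 * Module.finrank ℝ
      (Submodule.span ℝ (range fun k => mvfderiv (𝓡 n) (reImParts F S k) m)))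
    {a₁ a₂ : ℝ} (hrank : n ≤ Module.finrank ℝ (Submodule.span ℝ
      (range fun i => hamiltonianField (a₁ • B₁ + a₂ • B₂) x ψ i (x m))) + 1) :
    Odd n ∧ ∃ b₁ b₂ : LinearMap.BilinForm ℝ (Cotangent n m),
      IsAssociatedPairing B₁ m b₁ ∧ IsAssociatedPairing B₂ m b₂ ∧ IsKroneckerPair n b₁ b₂ ∧
        DecomposesIntoBlocks b₁ b₂ [n] := by
  have := finiteDimensional_cotangent (n := n) m
  obtain ⟨b₁, hb₁, -⟩ := hx.exists_isAssociatedPairing hB.1.1 hm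
  obtain ⟨b₂, hb₂, -⟩ := hx.exists_isAssociatedPairing hB.2.1.1 hm
  have halt₁ := hx.isAlt_of_isAssociatedPairing hm hB.1.1 hb₁
  have halt₂ := hx.isAlt_of_isAssociatedPairing hm hB.2.1.1 hb₂
  have hker := hx.finrank_ker_add_finrank_span (hB.2.2 a₁ a₂).1 hm (hb₁.add_smul hb₂ a₁ a₂)
  have hfin := LinearMap.BilinForm.finite_setOf_one_lt_finrank_ker b₁ b₂ a₁ a₂ (by omega)
  set G : Set ℝ := {s | Module.finrank ℝ (LinearMap.ker (s • b₁ + b₂)) ≤ 1} with hG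
  set Z : Submodule ℝ (Cotangent n m) :=
    Submodule.span ℝ {α | ∃ s ∈ G, s • b₁ α + b₂ α = 0} with hZ
  have hGd : Dense G := by
    have : G = {s | 1 < Module.finrank ℝ (LinearMap.ker (s • b₁ + b₂))}ᶜ := by
      ext s; simp [hG]
    rw [this]
    exact hfin.countable.dense_compl ℝ
  have hSG : S ⊆ closure (S ∩ G) := hGd.open_subset_closure_inter hS
  have hcas : ∀ (s : ℝ) (f : C^∞⟮𝓡 n, M; ℝ⟯), (∀ g, (s • B₁ + B₂) f g m = 0) → s ∈ G →
      mvfderiv (𝓡 n) f m ∈ Z := by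
    intro s f hf hs
    refine Submodule.subset_span ⟨s, hs, ?_⟩
    ext β
    obtain ⟨g, rfl⟩ := hx.exists_mvfderiv_eq_of_mem hm β
    change s * b₁ _ _ + b₂ _ _ = 0
    rw [hb₁, hb₂]
    exact hf g
  have hclosed : IsClosed (Z : Set (Cotangent n m)) := Z.closed_of_finiteDimensional
  -- For the finitely many bad `s` a Casimir differential need not lie in a kernel line; it is a
  -- limit of differentials at good parameters, and `Z` is closed.
  have hclos : ∀ f : ℝ → Cotangent n m, ContinuousOn f S → (∀ s ∈ S ∩ G, f s ∈ Z) →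
      ∀ s ∈ S, f s ∈ Z := by
    intro f hf hfZ s hs
    have h1 := ((hf s hs).mono inter_subset_left).mem_closure (hSG hs)
      (fun t ht => hfZ t ht : MapsTo f (S ∩ G) Z)
    rwa [hclosed.closure_eq] at h1
  have hre : ∀ s ∈ S, mvfderiv (𝓡 n) (rePart (F s)) m ∈ Z := by
    refine hclos _ ?_ fun s hs => hcas s _ (fun g => ((hF s hs.1).rePart_imPart g m).1) hs.2
    simp only [mvfderiv_rePart]
    exact ((ContinuousLinearMap.postcomp _ (RCLike.reCLM (K := 𝕜))).continuous).comp_continuousOn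
      hcont
  have him : ∀ s ∈ S, mvfderiv (𝓡 n) (imPart (F s)) m ∈ Z := by
    refine hclos _ ?_ fun s hs => hcas s _ (fun g => ((hF s hs.1).rePart_imPart g m).2) hs.2
    simp only [mvfderiv_imPart]
    exact ((ContinuousLinearMap.postcomp _ (RCLike.imCLM (K := 𝕜))).continuous).comp_continuousOn
      hcont
  have hle : Submodule.span ℝ (range fun k => mvfderiv (𝓡 n) (reImParts F S k) m) ≤ Z := by
    refine Submodule.span_le.2 ?_
    rintro _ ⟨⟨s, hs⟩ | ⟨s, hs⟩, rfl⟩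
    · exact hre s hs
    · exact him s hs
  have hfr := finrank_cotangent (n := n) m
  have hmain := isKroneckerPair_of_finrank_le halt₁ halt₂ (by rwa [hfr]) G (fun s hs => hs) (by
    rw [hfr]
    exact hdim.trans (Nat.mul_le_mul_left 2 (Submodule.finrank_mono hle)))
  obtain ⟨hodd, hkr, hind⟩ := hmain
  have hdec := hind.decomposesIntoBlocks
  rw [hfr] at hodd hkr hdec
  exact ⟨hodd, b₁, b₂, hb₁, hb₂, hkr, hdec⟩

end IsCoordinateMap

end MainTheorem

theorem mainTheorem2
    {n : ℕ} (hn : n ≠ 0)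
    {M : Type*} [TopologicalSpace M] [T2Space M]
    [ChartedSpace (EuclideanSpace ℝ (Fin n)) M] [IsManifold (𝓡 n) ∞ M]
    (B₁ B₂ : BilinearOperation n M) (hB : IsBihamiltonian B₁ B₂)
    {𝕜 : Type*} [RCLike 𝕜]
    (S : Set ℝ) (hS : IsOpen S)
    (F : ℝ → C^∞⟮𝓡 n, M; 𝓘(ℝ, 𝕜), 𝕜⟯)
    (hF : ∀ s ∈ S, IsCasimir (s • B₁ + B₂) (F s))
    (hcont : ∀ m : M, ContinuousOn (fun s => mvfderiv (𝓡 n) (F s) m) S)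
    (m₀ : M)
    (hdim : (n : ℝ) / 2 ≤ (Module.finrank 𝕜 (differentialSpan F S m₀) : ℝ))
    (a₁ a₂ : ℝ)
    (hCas : ∃ N : Set M, IsOpen N ∧ m₀ ∈ N ∧ ∀ V : Set M, IsOpen V → V ⊆ N →
      HasAtMostIndependentCasimirs (a₁ • B₁ + a₂ • B₂) 1 V) :
    Odd n ∧ ∃ U : Set M, IsOpen U ∧ m₀ ∈ closure U ∧
      IsHomogeneousOn B₁ B₂ [n] U ∧ IsKroneckerAtPointsOf B₁ B₂ n U := by
  obtain ⟨x, ψ, Ω, hm₀, hx⟩ := exists_isCoordinateMap (n := n) m₀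
  obtain ⟨N, hN, hm₀N, hCas⟩ := hCas
  let d : M → ℕ := fun m => Module.finrank ℝ
    (Submodule.span ℝ (range fun k => mvfderiv (𝓡 n) (reImParts F S k) m))
  let ρ : M → ℕ := fun m => Module.finrank ℝ (Submodule.span ℝ
    (range fun i => hamiltonianField (a₁ • B₁ + a₂ • B₂) x ψ i (x m)))
  have hd₀ : n ≤ 2 * d m₀ := by
    have h1 : (Module.finrank 𝕜 (differentialSpan F S m₀) : ℝ) ≤ d m₀ := by
      exact_mod_cast finrank_differentialSpan_le F S m₀
    have h2 : (n : ℝ) ≤ 2 * d m₀ := by linarith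
    exact_mod_cast h2
  set U : Set M := interior {m | m ∈ Ω ∧ n ≤ 2 * d m ∧ n ≤ ρ m + 1} with hU
  have hcl : m₀ ∈ closure U := by
    refine mem_closure_iff_nhds.2 fun O hO => ?_
    have hev : ∀ᶠ m in 𝓝 m₀, m ∈ O ∧ m ∈ Ω ∧ m ∈ N ∧ n ≤ 2 * d m := by
      filter_upwards [hO, hx.isOpen.mem_nhds hm₀, hN.mem_nhds hm₀N,
        hx.eventually_finrank_span_mvfderiv_le (reImParts F S) hm₀] with m h1 h2 h3 h4
      exact ⟨h1, h2, h3, hd₀.trans (Nat.mul_le_mul_left 2 h4)⟩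
    obtain ⟨O', hO', hO'o, hm₀O'⟩ := eventually_nhds_iff.1 hev
    -- Otherwise the corank is at least two on all of `O'`, which produces two independent Casimir
    -- functions inside `N`.
    have hex : ∃ m ∈ O', n ≤ ρ m + 1 := by
      by_contra! hlt
      obtain ⟨V, hVO, hVo, f, hf, hnd⟩ := (hx.mono hO'o fun m hm =>
        (hO' m hm).2.1).exists_independent_casimirs (hB.2.2 a₁ a₂) ⟨m₀, hm₀O'⟩
        fun m hm => hlt m hm
      exact hnd (hCas V hVo (fun m hm => (hO' m (hVO hm)).2.2.1) f hf)
    obtain ⟨m₁, hm₁, hρ⟩ := hex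
    refine ⟨m₁, (hO' m₁ hm₁).1, mem_interior_iff_mem_nhds.2 ?_⟩
    filter_upwards [hO'o.mem_nhds hm₁, hx.eventually_finrank_span_hamiltonianField_le
      (a₁ • B₁ + a₂ • B₂) (hO' m₁ hm₁).2.1] with m h1 h2
    exact ⟨(hO' m h1).2.1, (hO' m h1).2.2.2, hρ.trans (Nat.add_le_add_right h2 1)⟩
  have hmain := fun m (hm : m ∈ U) =>
    have h := interior_subset hm
    hx.isKroneckerPair hn hB hS hF h.1 (hcont m) h.2.1 h.2.2
  obtain ⟨m₁, hm₁⟩ := closure_nonempty_iff.1 ⟨m₀, hcl⟩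
  refine ⟨(hmain m₁ hm₁).1, U, isOpen_interior, hcl, fun m hm => ?_, fun m hm => ?_⟩
  · obtain ⟨-, b₁, b₂, h₁, h₂, -, h⟩ := hmain m hm
    exact ⟨b₁, b₂, h₁, h₂, h⟩
  · obtain ⟨-, b₁, b₂, h₁, h₂, h, -⟩ := hmain m hm
    exact ⟨b₁, b₂, h₁, h₂, h⟩
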